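/- Let $m\ge n\ge 0$, $G=GL(m+n,\mathbb C)$ and $K=GL(m)\times GL(n)\subset G$ (block diagonal matrices $k=(k_1,k_2)$). Write elements of $G$ in blocks of sizes $n,\,m-n,\,n$, let $$\tilde J=\begin{pmatrix}\frac1{\sqrt2}I_n&0&-\frac1{\sqrt2}I_n\\0&I_{m-n}&0\\\frac1{\sqrt2}I_n&0&\frac1{\sqrt2}I_n\end{pmatrix},\qquad e^{a(x)}=\tilde J\,e^{\mathrm{diag}(x,0,-x)}\,\tilde J^{-1}=\begin{pmatrix}\cosh x&0&\sinh x\\0&I_{m-n}&0\\\sinh x&0&\cosh x\end{pmatrix}\quad(x\in\mathbb C^n).$$ Let $\varkappa_{(1)},\varkappa_{(2)},\tilde\varkappa_{(1)}\in\mathbb Z$ and $\varkappa_v\in\mathbb Z_{\ge0}$, and put $(\kappa_1,\kappa_2,\kappa_3)=(\varkappa_{(2)}-\varkappa_{(1)},\ \varkappa_v,\ \tilde\varkappa_{(1)}-\varkappa_{(2)})$. Assume $\kappa_3\ge\kappa_1+\kappa_3\ge0$. Let $W$ be the irreducible finite-dimensional algebraic representation of $GL(m)$ with highest weight $(\tilde\varkappa_{(1)},\dots,\tilde\varkappa_{(1)},\varkappa_{(1)},\dots,\varkappa_{(1)})$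 ($n$ entries $\tilde\varkappa_{(1)}$ and $m-n$ entries $\varkappa_{(1)}$), let $V=S^{\varkappa_v n}\mathbb C^n\otimes\det^{-\varkappa_v+\varkappa_{(1)}+\varkappa_{(2)}-\tilde\varkappa_{(1)}}$ as a representation of $GL(n)$, and let $U=W\boxtimes V$. Let $F_{\vec\varkappa}$ be the space of polynomial functions $f:G\to U$ (polynomial in the matrix entries and $\det^{-1}$) such that $$f(gk)=\det(k_1)^{\varkappa_{(1)}}\det(k_2)^{\varkappa_{(2)}}f(g),\qquad f(kg)=k\,f(g)\qquad(g\in G,\ k=(k_1,k_2)\in K).$$ Let $\tilde U=\tilde W\boxtimes\tilde V\subset U$, where $\tilde W\subset W$ is the subspace on which the subgroup $GL(m-n)\subset GL(m)$ (last $m-n$ coordinates) acts by $\det^{\varkappa_{(1)}}$, and $\tilde V\subset V$ is the weight space of weight $(\varkappa_{(1)}+\varkappa_{(2)}-\tilde\varkappa_{(1)})(1,\dots,1)$. Let $\mathbb C[P]$ be the algebra of Laurent polynomials in $e^{x_1},\dots,e^{x_n}$, and let $$\delta_{\vec\kappa}(x)=\prod_{i}\sinh^{\kappa_1}(x_i)\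 \prod_{i<j}\sinh^{\kappa_2}(x_i-x_j)\sinh^{\kappa_2}(x_i+x_j)\ \prod_i\sinh^{\kappa_3}(2x_i).$$ Then $\tilde U$ is one-dimensional, and $\delta_{\vec\kappa}$ is (that is, coincides wherever all $\sinh x_i\ne0$ with) an element of $\mathbb C[P]$. Moreover, for every $f\in F_{\vec\varkappa}$ the restriction $x\mapsto f(e^{a(x)})$ takes values in $\tilde U$, and after any identification $\tilde U\cong\mathbb C$ (given by a non-zero vector of $\tilde U$) it is an element of $\mathbb C[P]$ which is divisible by $\delta_{\vec\kappa}$ in the algebra $\mathbb C[P]$. -/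

import Mathlib

namespace BCSpherical

/-! ### Regular functions and representations of general linear groups -/

section GeneralLinear

variable {ι : Type*} [Fintype ι] [DecidableEq ι]

/-- The algebra `ℂ[GL(ι)]` of polynomial functions on the algebraic group `GL(ι, ℂ)`: it is
generated by the matrix entries and by the inverse of the determinant. -/
def regularFunctions (ι : Type*) [Fintype ι] [DecidableEq ι] : Subalgebra ℂ (GL ι ℂ → ℂ) :=
  Algebra.adjoin ℂ
    (Set.range (fun (ij : ι × ι) (g : GL ι ℂ) => (g : Matrix ι ι ℂ) ij.1 ij.2) ∪
      {fun g : GL ι ℂ => ((g : Matrix ι ι ℂ).det)⁻¹})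

/-- Polynomial functions on `GL(ι, ℂ)` with values in a vector space `U` (for finite dimensional
`U`, these are the elements of `ℂ[GL(ι)] ⊗ U`). -/
def IsRegularMap {U : Type*} [AddCommGroup U] [Module ℂ U] (f : GL ι ℂ → U) : Prop :=
  ∀ ℓ : Module.Dual ℂ U, (fun g => ℓ (f g)) ∈ regularFunctions ι

/-- The determinant of `GL(ι, ℂ)`, to an integral power, as a complex number. -/
noncomputable def detPow (e : ℤ) (g : GL ι ℂ) : ℂ := ((g : Matrix ι ι ℂ).det) ^ e

/-- The diagonal torus of `GL(ι, ℂ)`. -/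
def diagTorus (t : ι → ℂˣ) : GL ι ℂ where
  val := Matrix.diagonal fun i => (t i : ℂ)
  inv := Matrix.diagonal fun i => ((t i)⁻¹ : ℂˣ)
  val_inv := by simp [Matrix.diagonal_mul_diagonal]
  inv_val := by simp [Matrix.diagonal_mul_diagonal]

/-- `ρ` is (a model of) the representation `L_μ`: a finite dimensional, algebraic, irreducible
representation of `GL(ι, ℂ)` which contains a highest weight vector of weight `μ`, i.e. a non-zero
vector on which every invertible upper triangular matrix `b` acts by `∏ i, b i i ^ μ i`. Upper
triangularity refers to the order of the indices given by `o`. -/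
structure IsHighestWeightIrrep {β : Type*} [LinearOrder β] (o : ι → β) (μ : ι → ℤ)
    {W : Type*} [AddCommGroup W] [Module ℂ W] (ρ : Representation ℂ (GL ι ℂ) W) : Prop where
  finite : FiniteDimensional ℂ W
  algebraic : ∀ w : W, IsRegularMap fun g => ρ g w
  irreducible : ρ.IsIrreducible
  highest : ∃ w : W, w ≠ 0 ∧ ∀ b : GL ι ℂ, (b : Matrix ι ι ℂ).BlockTriangular o →
    ρ b w = (∏ i, ((b : Matrix ι ι ℂ) i i) ^ μ i) • w

/-- The linear substitution `X j ↦ ∑ i, g i j X i` on polynomials, i.e. the action of `g` on the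
symmetric algebra of `ℂ^n`, where `X j` is the `j`-th basis vector of `ℂ^n`. -/
noncomputable def linSubst {n : ℕ} (g : Matrix (Fin n) (Fin n) ℂ) :
    MvPolynomial (Fin n) ℂ →ₐ[ℂ] MvPolynomial (Fin n) ℂ :=
  MvPolynomial.aeval fun j => ∑ i, g i j • MvPolynomial.X i

theorem linSubst_one {n : ℕ} : linSubst (1 : Matrix (Fin n) (Fin n) ℂ) = AlgHom.id ℂ _ := by
  apply MvPolynomial.algHom_ext
  intro j
  simp [linSubst, Matrix.one_apply, ite_smul]

theorem linSubst_mul {n : ℕ} (g h : Matrix (Fin n) (Fin n) ℂ) :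
    linSubst (g * h) = (linSubst g).comp (linSubst h) := by
  apply MvPolynomial.algHom_ext
  intro j
  simp only [linSubst, MvPolynomial.aeval_X, AlgHom.comp_apply, map_sum, map_smul,
    Matrix.mul_apply, Finset.sum_smul, Finset.smul_sum, smul_smul]
  rw [Finset.sum_comm]
  refine Finset.sum_congr rfl fun i _ => Finset.sum_congr rfl fun k _ => ?_
  rw [mul_comm]

theorem linSubst_mem {n d : ℕ} (g : Matrix (Fin n) (Fin n) ℂ) {q : MvPolynomial (Fin n) ℂ}
    (hq : q ∈ MvPolynomial.homogeneousSubmodule (Fin n) ℂ d) :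
    linSubst g q ∈ MvPolynomial.homogeneousSubmodule (Fin n) ℂ d := by
  rw [MvPolynomial.mem_homogeneousSubmodule] at hq ⊢
  have h := hq.aeval (fun j => ∑ i, g i j • (MvPolynomial.X i : MvPolynomial (Fin n) ℂ)) (n := 1)
    (fun j => MvPolynomial.IsHomogeneous.sum _ _ _ fun i _ => by
      rw [MvPolynomial.smul_eq_C_mul]
      exact (MvPolynomial.isHomogeneous_X ℂ i).C_mul (g i j))
  simpa [linSubst] using h

/-- The `d`-th symmetric power `S^d ℂ^n`: homogeneous polynomials of degree `d` in the basis
vectors of `ℂ^n`. -/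
abbrev SymPow (n d : ℕ) : Type := MvPolynomial.homogeneousSubmodule (Fin n) ℂ d

/-- The representation `S^d ℂ^n ⊗ det^e` of `GL(n)`. -/
noncomputable def symPowDet (n d : ℕ) (e : ℤ) :
    Representation ℂ (GL (Fin n) ℂ) (SymPow n d) where
  toFun g := detPow e g • (linSubst (g : Matrix (Fin n) (Fin n) ℂ)).toLinearMap.restrict
    fun _ hq => linSubst_mem _ hq
  map_one' := by
    ext q : 2
    simp [detPow, linSubst_one, LinearMap.restrict_apply]
  map_mul' g h := by
    ext q : 2
    simp only [detPow, Units.val_mul, Matrix.det_mul, linSubst_mul, mul_zpow, mul_smul,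
      LinearMap.smul_apply, LinearMap.restrict_apply, Module.End.mul_apply, map_smul,
      AlgHom.toLinearMap_apply, AlgHom.comp_apply, Submodule.coe_smul]
    rw [smul_comm]
    rfl

end GeneralLinear

/-! ### The symmetric pair `(GL(m+n), GL(m) × GL(n))` with `m = n + p` -/

/-- Indices of `GL(m)`, `m = n + p`, split as `n + p`. -/
abbrev Idx₁ (n p : ℕ) : Type := Fin n ⊕ Fin p

/-- Indices of `GL(m+n)`, `m = n + p`, split as `n + p + n`. -/
abbrev Idx (n p : ℕ) : Type := Idx₁ n p ⊕ Fin n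

section Pair

variable {n p : ℕ}

/-- Block diagonal matrices; for `GL(m)` and `GL(n)` this parametrises the subgroup
`K = GL(m) × GL(n)` of `GL(m+n)`. -/
def blockDiag {ι₁ ι₂ : Type*} [Fintype ι₁] [DecidableEq ι₁] [Fintype ι₂] [DecidableEq ι₂]
    (a : GL ι₁ ℂ) (b : GL ι₂ ℂ) : GL (ι₁ ⊕ ι₂) ℂ where
  val := Matrix.fromBlocks (a : Matrix ι₁ ι₁ ℂ) 0 0 (b : Matrix ι₂ ι₂ ℂ)
  inv := Matrix.fromBlocks (↑a⁻¹ : Matrix ι₁ ι₁ ℂ) 0 0 (↑b⁻¹ : Matrix ι₂ ι₂ ℂ)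
  val_inv := by
    rw [Matrix.fromBlocks_multiply]
    simp only [Units.mul_inv, Matrix.mul_zero, Matrix.zero_mul, add_zero, zero_add,
      Matrix.fromBlocks_one]
  inv_val := by
    rw [Matrix.fromBlocks_multiply]
    simp only [Units.inv_mul, Matrix.mul_zero, Matrix.zero_mul, add_zero, zero_add,
      Matrix.fromBlocks_one]

/-- A matrix of size `n + p + n` of the form
`(diag a, 0, diag b; 0, 1, 0; diag c, 0, diag d)`. -/
def diagBlocks (a b c d : Fin n → ℂ) : Matrix (Idx n p) (Idx n p) ℂ :=
  Matrix.fromBlocks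
    (Matrix.fromBlocks (Matrix.diagonal a) 0 0 1)
    (Matrix.fromRows (Matrix.diagonal b) 0)
    (Matrix.fromCols (Matrix.diagonal c) 0)
    (Matrix.diagonal d)

theorem diagBlocks_mul (a b c d a' b' c' d' : Fin n → ℂ) :
    diagBlocks (p := p) a b c d * diagBlocks a' b' c' d' =
      diagBlocks (a * a' + b * c') (a * b' + b * d') (c * a' + d * c') (c * b' + d * d') := by
  ext i j
  rcases i with (i | i) | i <;> rcases j with (j | j) | j <;>
    simp [diagBlocks, Matrix.mul_apply, Fintype.sum_sum_type, Matrix.fromBlocks,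
      Matrix.diagonal_apply, Matrix.one_apply] <;> split_ifs <;> simp_all

theorem diagBlocks_one : diagBlocks (n := n) (p := p) 1 0 0 1 = 1 := by
  ext i j
  rcases i with (i | i) | i <;> rcases j with (j | j) | j <;>
    simp [diagBlocks, Matrix.fromBlocks, Matrix.one_apply]

theorem inv_sqrt_two_mul_self : ((Real.sqrt 2 : ℂ))⁻¹ * ((Real.sqrt 2 : ℂ))⁻¹ = 1 / 2 := by
  rw [← mul_inv, ← Complex.ofReal_mul, Real.mul_self_sqrt (by norm_num)]
  norm_num

/-- The matrix `J̃`, with blocks `(1/√2, 0, -1/√2; 0, 1, 0; 1/√2, 0, 1/√2)`; it conjugates the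
diagonal torus of `GL(m+n)` to the Cartan subgroup `H`. -/
noncomputable def Jtilde (n p : ℕ) : GL (Idx n p) ℂ where
  val := diagBlocks (fun _ => (Real.sqrt 2 : ℂ)⁻¹) (fun _ => -(Real.sqrt 2 : ℂ)⁻¹)
    (fun _ => (Real.sqrt 2 : ℂ)⁻¹) (fun _ => (Real.sqrt 2 : ℂ)⁻¹)
  inv := diagBlocks (fun _ => (Real.sqrt 2 : ℂ)⁻¹) (fun _ => (Real.sqrt 2 : ℂ)⁻¹)
    (fun _ => -(Real.sqrt 2 : ℂ)⁻¹) (fun _ => (Real.sqrt 2 : ℂ)⁻¹)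
  val_inv := by
    rw [diagBlocks_mul, ← diagBlocks_one]
    congr 1 <;> ext i <;> simp [inv_sqrt_two_mul_self] <;> norm_num
  inv_val := by
    rw [diagBlocks_mul, ← diagBlocks_one]
    congr 1 <;> ext i <;> simp [inv_sqrt_two_mul_self] <;> norm_num

/-- The element `exp z` of `ℂˣ`. -/
noncomputable def expUnit (z : ℂ) : ℂˣ := Units.mk0 (Complex.exp z) (Complex.exp_ne_zero z)

/-- The element `h(x, y, z) = J̃ e^{diag(x, y, z)} J̃⁻¹` of the Cartan subgroup `H`. -/
noncomputable def hElt (x : Fin n → ℂ) (y : Fin p → ℂ) (z : Fin n → ℂ) : GL (Idx n p) ℂ :=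
  Jtilde n p * diagTorus (Sum.elim (Sum.elim (fun i => expUnit (x i)) fun i => expUnit (y i))
    fun i => expUnit (z i)) * (Jtilde n p)⁻¹

/-- The element `e^{a(x)} = h(x, 0, -x)` of the torus `A`. -/
noncomputable def expA (p : ℕ) (x : Fin n → ℂ) : GL (Idx n p) ℂ := hElt x 0 (-x)

/-- Explicitly, `e^{a(x)}` has blocks `(cosh x, 0, sinh x; 0, 1, 0; sinh x, 0, cosh x)`. -/
theorem coe_expA (x : Fin n → ℂ) :
    (expA p x : Matrix (Idx n p) (Idx n p) ℂ) =
      diagBlocks (fun i => Complex.cosh (x i)) (fun i => Complex.sinh (x i))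
        (fun i => Complex.sinh (x i)) (fun i => Complex.cosh (x i)) := by
  have hD : ((diagTorus (Sum.elim (Sum.elim (fun i => expUnit (x i))
      fun i => expUnit ((0 : Fin p → ℂ) i)) fun i => expUnit ((-x) i)) : GL (Idx n p) ℂ) :
        Matrix (Idx n p) (Idx n p) ℂ) =
      diagBlocks (fun i => Complex.exp (x i)) 0 0 (fun i => Complex.exp (-x i)) := by
    ext i j
    rcases i with (i | i) | i <;> rcases j with (j | j) | j <;>
      simp [diagTorus, diagBlocks, expUnit, Matrix.fromBlocks, Matrix.diagonal_apply,
        Matrix.one_apply]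
  have h1 : ((Jtilde n p : GL (Idx n p) ℂ) : Matrix (Idx n p) (Idx n p) ℂ) =
    diagBlocks (fun _ => (Real.sqrt 2 : ℂ)⁻¹) (fun _ => -(Real.sqrt 2 : ℂ)⁻¹)
    (fun _ => (Real.sqrt 2 : ℂ)⁻¹) (fun _ => (Real.sqrt 2 : ℂ)⁻¹) := rfl
  have h2 : (((Jtilde n p)⁻¹ : GL (Idx n p) ℂ) : Matrix (Idx n p) (Idx n p) ℂ) =
    diagBlocks (fun _ => (Real.sqrt 2 : ℂ)⁻¹) (fun _ => (Real.sqrt 2 : ℂ)⁻¹)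
    (fun _ => -(Real.sqrt 2 : ℂ)⁻¹) (fun _ => (Real.sqrt 2 : ℂ)⁻¹) := rfl
  have hs := inv_sqrt_two_mul_self
  rw [expA, hElt, Units.val_mul, Units.val_mul, hD, h1, h2, diagBlocks_mul, diagBlocks_mul]
  congr 1 <;> ext i <;> simp [Complex.cosh, Complex.sinh]
  · linear_combination (Complex.exp (x i) + Complex.exp (-x i)) * hs
  · linear_combination (Complex.exp (x i) - Complex.exp (-x i)) * hs
  · linear_combination (Complex.exp (x i) - Complex.exp (-x i)) * hs
  · linear_combination (Complex.exp (x i) + Complex.exp (-x i)) * hs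

end Pair

/-! ### The representation `U` of `K` and spherical functions -/

/-- The vector of parameters `(ϰ₍₁₎, ϰ₍₂₎, ϰ̃₍₁₎, ϰ_v)`. -/
structure Param where
  k₁ : ℤ
  k₂ : ℤ
  kt₁ : ℤ
  kv : ℕ

namespace Param

variable (c : Param)

/-- `κ₁ = ϰ₍₂₎ - ϰ₍₁₎`. -/
def κ₁ : ℤ := c.k₂ - c.k₁

/-- `κ₂ = ϰ_v`. -/
def κ₂ : ℤ := c.kv

/-- `κ₃ = ϰ̃₍₁₎ - ϰ₍₂₎`. -/
def κ₃ : ℤ := c.kt₁ - c.k₂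

/-- The weight `(ϰ̃₍₁₎ - ϰ₍₁₎) 1^n + ϰ₍₁₎ 1^m` of `GL(m)`, `m = n + p`. -/
def weightW (n p : ℕ) : Idx₁ n p → ℤ := Sum.elim (fun _ => c.kt₁) (fun _ => c.k₁)

/-- `ρ` is the irreducible representation `W` of `GL(m)`, `m = n + p`, with highest weight
`(ϰ̃₍₁₎ - ϰ₍₁₎) 1^n + ϰ₍₁₎ 1^m`. -/
def IsW {n p : ℕ} {W : Type*} [AddCommGroup W] [Module ℂ W]
    (ρ : Representation ℂ (GL (Idx₁ n p) ℂ) W) : Prop :=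
  IsHighestWeightIrrep toLex (c.weightW n p) ρ

/-- The space of the representation `V` of `GL(n)`. -/
abbrev V (n : ℕ) : Type := SymPow n (c.kv * n)

/-- The representation `V = L_λ ⊗ det^{ϰ₍₂₎ + ϰ₍₁₎ - ϰ̃₍₁₎}` of `GL(n)`, where
`L_λ = S^{ϰ_v n} ℂ^n ⊗ det^{-ϰ_v}` is `S^{ϰ_v n} ℂ^n` made trivial on the centre, i.e.
`λ = (ϰ_v (n - 1), -ϰ_v, …, -ϰ_v)`. -/
noncomputable def repV (n : ℕ) : Representation ℂ (GL (Fin n) ℂ) (c.V n) :=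
  symPowDet n (c.kv * n) (-(c.kv : ℤ) + (c.k₂ + c.k₁ - c.kt₁))

section Spherical

variable {n p : ℕ} {W : Type*} [AddCommGroup W] [Module ℂ W]

open scoped TensorProduct

/-- The space of spherical functions: polynomial functions `f` on `G = GL(m+n)` with values in
`U = W ⊠ V`, such that `f(gk) = f(g) det(k₁)^{ϰ₍₁₎} det(k₂)^{ϰ₍₂₎}` and `f(kg) = k f(g)` for
`k = (k₁, k₂)` in `K = GL(m) × GL(n)`. -/
structure IsSpherical (ρ : Representation ℂ (GL (Idx₁ n p) ℂ) W)
    (f : GL (Idx n p) ℂ → W ⊗[ℂ] c.V n) : Prop where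
  regular : IsRegularMap f
  right : ∀ (g : GL (Idx n p) ℂ) (a : GL (Idx₁ n p) ℂ) (b : GL (Fin n) ℂ),
    f (g * blockDiag a b) = (detPow c.k₁ a * detPow c.k₂ b) • f g
  left : ∀ (g : GL (Idx n p) ℂ) (a : GL (Idx₁ n p) ℂ) (b : GL (Fin n) ℂ),
    f (blockDiag a b * g) = TensorProduct.map (ρ a) (c.repV n b) (f g)

/-- The subspace `W̃` of `W` on which `M = GL(m - n) = GL(p)` acts by `det^{ϰ₍₁₎}`. -/
def subW (ρ : Representation ℂ (GL (Idx₁ n p) ℂ) W) : Submodule ℂ W where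
  carrier := {w | ∀ y : GL (Fin p) ℂ, ρ (blockDiag 1 y) w = detPow c.k₁ y • w}
  zero_mem' y := by simp
  add_mem' hv hw y := by rw [map_add, hv y, hw y, smul_add]
  smul_mem' z w hw y := by rw [map_smul, hw y, smul_comm]

/-- The weight subspace `Ṽ` of `V`, of weight `(ϰ₍₁₎ + ϰ₍₂₎ - ϰ̃₍₁₎) 1^n`. -/
def subV (n : ℕ) : Submodule ℂ (c.V n) where
  carrier := {v | ∀ t : Fin n → ℂˣ,
    c.repV n (diagTorus t) v = (∏ i, (t i : ℂ) ^ (c.k₁ + c.k₂ - c.kt₁)) • v}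
  zero_mem' y := by simp
  add_mem' hv hw y := by rw [map_add, hv y, hw y, smul_add]
  smul_mem' z w hw y := by rw [map_smul, hw y, smul_comm]

/-- The subspace `Ũ = W̃ ⊠ Ṽ` of `U`. -/
noncomputable def subU (ρ : Representation ℂ (GL (Idx₁ n p) ℂ) W) :
    Submodule ℂ (W ⊗[ℂ] c.V n) :=
  LinearMap.range (TensorProduct.mapIncl (c.subW ρ) (c.subV n))

end Spherical

end Param

/-! ### Laurent polynomials and the generalised Weyl denominator -/

/-- The algebra `ℂ[P]` of Laurent polynomials in `e^{x_1}, …, e^{x_n}`, i.e. the group algebra of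
the lattice `P = ℤ^n`. -/
abbrev LaurentAlg (n : ℕ) : Type := AddMonoidAlgebra ℂ (Fin n → ℤ)

/-- The value at `x` of an element of `ℂ[P]`: the basis vector `ν` has value `e^{(ν, x)}`. -/
noncomputable def evalAt {n : ℕ} (x : Fin n → ℂ) : LaurentAlg n →ₐ[ℂ] ℂ :=
  AddMonoidAlgebra.lift ℂ ℂ (Fin n → ℤ)
    { toFun := fun ν => Complex.exp (∑ i, (ν.toAdd i : ℂ) * x i)
      map_one' := by simp
      map_mul' := fun ν ν' => by
        simp [add_mul, Finset.sum_add_distrib, Complex.exp_add] }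

/-- The generalised Weyl denominator `δ_κ(x) = ∏ sinh^{κ_α}(α(a(x)))`, the product being over the
positive roots `ε_i`, `ε_i ± ε_j` (`i < j`) and `2 ε_i` of `BC_n`, with exponents `κ₁`, `κ₂` and
`κ₃`. -/
noncomputable def weylDenominator {n : ℕ} (κ₁ κ₂ κ₃ : ℤ) (x : Fin n → ℂ) : ℂ :=
  (∏ i, Complex.sinh (x i) ^ κ₁) *
  (∏ i, ∏ j ∈ Finset.Ioi i,
    Complex.sinh (x i - x j) ^ κ₂ * Complex.sinh (x i + x j) ^ κ₂) *
  ∏ i, Complex.sinh (2 * x i) ^ κ₃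

end BCSpherical

open BCSpherical

namespace BCSpherical

open Matrix Polynomial

/-! The divisibility comes from moving `e^{a(x)}` inside its double coset of `K` to a point whose
coordinates are polynomial in the `z_i = sinh² x_i`. Let `Z` be the bidiagonal matrix with diagonal
`z` and `-1` above it, and `N` its eigenvector matrix, made of values of Newton polynomials. With `s
= diag(sinh x)` and `c = diag(cosh x)`, at regular `x`, `(1,0,1; 0,1,0; Z,0,1+Z) · diag(N s⁻¹, 1, N
c⁻¹) = diag(N (sc)⁻¹, 1, N) · e^{a(x)}` (`shearGL_mul_blockDiag`, `bidiag_mul_newton`). Apply a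
spherical `f` to both sides, then a functional normalised on the highest weight vector of `W`,
tensored with evaluation of `V` at the first basis vector. The first row of `N` consists of ones, so
the evaluation of `N · (X_1 ⋯ X_n)^{ϰ_v}` is just a power of `det N`. Collecting determinants,
`f(e^{a(x)})` equals `(det N)^{ϰ_v} ∏ sinh^{κ₁+κ₃} x_i ∏ cosh^{κ₃} x_i` times a functional of `f` at
the shear matrix (`IsSpherical.apply_expA_eq`). Since `det N = ∏_{i<j} sinh(x_i-x_j) sinh(x_i+x_j)`,
the prefactor is `δ` up to a power of 2. The shear matrix has determinant 1 and entries in `ℂ[P]`,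
so the cofactor is a Laurent polynomial even where `N`, `s` or `c` degenerates; the identity extends
from regular points because `ℂ[P]` is a domain.

That `Ũ` is a line and contains the restrictions is highest weight theory: `W̃` is spanned by the
highest weight vector (`subW_eq_span`), `Ṽ` by the monomial `(X_1 ⋯ X_n)^{ϰ_v}` (`subV_eq_span`),
and the part of `K` commuting with `A` forces the values into `W̃ ⊠ Ṽ`
(`IsSpherical.apply_expA_mem`). -/

theorem transvection_map {ι : Type*} [DecidableEq ι] {i j : ι} {R S : Type*} [CommRing R]
    [CommRing S] (F : Type*)
    [FunLike F R S] [RingHomClass F R S] (f : F) (t : R) :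
    (transvection i j t).map f = transvection i j (f t) := by
  ext a b
  simp only [transvection, map_apply, Matrix.add_apply, map_add, Matrix.single_apply, one_apply]
  split_ifs <;> simp

/-! ### Regular functions along matrix families, and semi-invariance of highest weight vectors. -/

section General

variable {ι : Type*} [Fintype ι] [DecidableEq ι]

/-- A regular function on a family of matrices over a `ℂ`-algebra is given, up to a power of the
determinant, by an element of the algebra. -/
theorem exists_det_pow_mul_eq {R : Type*} [CommRing R] [Algebra ℂ R] (M : Matrix ι ι R)
    {r : GL ι ℂ → ℂ} (hr : r ∈ regularFunctions ι) :
    ∃ (k : ℕ) (q : R), ∀ (ev : R →ₐ[ℂ] ℂ) (g : GL ι ℂ), (g : Matrix ι ι ℂ) = M.map ev →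
      (g : Matrix ι ι ℂ).det ^ k * r g = ev q := by
  induction hr using Algebra.adjoin_induction with
  | mem r hr =>
    rcases hr with ⟨ij, rfl⟩ | rfl
    · exact ⟨0, M ij.1 ij.2, fun ev g hg => by simp [hg]⟩
    · refine ⟨1, 1, fun ev g hg => ?_⟩
      have : (g : Matrix ι ι ℂ).det ≠ 0 := (Matrix.isUnits_det_units g).ne_zero
      simp [this]
  | algebraMap z => exact ⟨0, algebraMap ℂ R z, fun ev g hg => by simp⟩
  | add r₁ r₂ _ _ h₁ h₂ =>
    obtain ⟨k₁, q₁, h₁⟩ := h₁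
    obtain ⟨k₂, q₂, h₂⟩ := h₂
    refine ⟨k₁ + k₂, M.det ^ k₂ * q₁ + M.det ^ k₁ * q₂, fun ev g hg => ?_⟩
    have hd : ev M.det = (g : Matrix ι ι ℂ).det := by rw [hg, AlgHom.map_det]; rfl
    rw [map_add, map_mul, map_mul, map_pow, map_pow, hd, ← h₁ ev g hg, ← h₂ ev g hg, Pi.add_apply]
    ring
  | mul r₁ r₂ _ _ h₁ h₂ =>
    obtain ⟨k₁, q₁, h₁⟩ := h₁
    obtain ⟨k₂, q₂, h₂⟩ := h₂
    refine ⟨k₁ + k₂, q₁ * q₂, fun ev g hg => ?_⟩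
    rw [map_mul, ← h₁ ev g hg, ← h₂ ev g hg, Pi.mul_apply]
    ring

/-- Along a family of determinant 1 no denominator survives. This produces the polynomials along
unipotent subgroups and the Laurent cofactor at the shear matrix. -/
theorem exists_eval_eq {R : Type*} [CommRing R] [Algebra ℂ R] (M : Matrix ι ι R) (hM : M.det = 1)
    {r : GL ι ℂ → ℂ} (hr : r ∈ regularFunctions ι) :
    ∃ q : R, ∀ (ev : R →ₐ[ℂ] ℂ) (g : GL ι ℂ), (g : Matrix ι ι ℂ) = M.map ev → r g = ev q := by
  obtain ⟨k, q, h⟩ := exists_det_pow_mul_eq M hr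
  refine ⟨q, fun ev g hg => ?_⟩
  have hd : (g : Matrix ι ι ℂ).det = 1 := by
    rw [hg, ← map_one ev, ← hM, AlgHom.map_det]; rfl
  simpa [hd] using h ev g hg

/-- A polynomial which is also a polynomial in the inverse of the variable is constant. -/
theorem eval_eq_of_eval_inv {P Q : ℂ[X]} (h : ∀ u : ℂ, u ≠ 0 → P.eval u⁻¹ = Q.eval u) (t : ℂ) :
    P.eval t = P.eval 0 := by
  -- Clearing denominators turns the relation into a polynomial identity. Its right side has degree
  -- at most `deg Q`, which leaves degree 0 for `P`.
  have key : X ^ Q.natDegree * P = Q.reverse := by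
    apply Polynomial.eq_of_infinite_eval_eq
    apply Set.Infinite.mono (s := {0}ᶜ)
    · intro u hu
      have hu : u ≠ 0 := hu
      have h1 := h u⁻¹ (inv_ne_zero hu)
      rw [inv_inv] at h1
      let : Invertible u⁻¹ := invertibleOfNonzero (inv_ne_zero hu)
      have h2 := Polynomial.eval₂_reverse_mul_pow (RingHom.id ℂ) u⁻¹ Q
      simp only [invOf_eq_inv, inv_inv] at h2
      simp only [Set.mem_ofPred_eq, eval_mul, eval_pow, eval_X, h1]
      rw [eval, ← h2, eval, mul_comm, mul_assoc, ← mul_pow, inv_mul_cancel₀ hu, one_pow, mul_one]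
    · exact (Set.finite_singleton _).infinite_compl
  by_cases hP : P = 0
  · simp [hP]
  have hd := congrArg natDegree key
  rw [natDegree_X_pow_mul _ hP] at hd
  have := Q.reverse_natDegree_le
  rw [Polynomial.eq_C_of_natDegree_eq_zero (p := P) (by omega)]
  simp

theorem eq_of_forall_dual {W : Type*} [AddCommGroup W] [Module ℂ W] {v w : W}
    (h : ∀ ℓ : Module.Dual ℂ W, ℓ v = ℓ w) : v = w := by
  rw [← sub_eq_zero, ← Module.forall_dual_apply_eq_zero_iff ℂ]
  intro ℓ
  rw [map_sub, h, sub_self]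

/-- Elementary matrices, as elements of the general linear group. -/
def transvectionGL {i j : ι} (h : i ≠ j) (t : ℂ) : GL ι ℂ where
  val := transvection i j t
  inv := transvection i j (-t)
  val_inv := by rw [transvection_mul_transvection_same _ _ h]; simp
  inv_val := by rw [transvection_mul_transvection_same _ _ h]; simp

theorem coe_transvectionGL {i j : ι} (h : i ≠ j) (t : ℂ) :
    (transvectionGL h t : Matrix ι ι ℂ) = transvection i j t := rfl

theorem transvectionGL_inv {i j : ι} (h : i ≠ j) (t : ℂ) :
    (transvectionGL h t)⁻¹ = transvectionGL h (-t) := by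
  apply Units.ext; rfl

variable {β : Type*} [LinearOrder β] {o : ι → β} {μ : ι → ℤ} {W : Type*} [AddCommGroup W]
  [Module ℂ W] {ρ : Representation ℂ (GL ι ℂ) W}

theorem exists_polynomial_transvection (halg : ∀ w : W, IsRegularMap fun g => ρ g w)
    {i j : ι} (h : i ≠ j) (w : W) (ℓ : Module.Dual ℂ W) :
    ∃ P : ℂ[X], ∀ t, ℓ (ρ (transvectionGL h t) w) = P.eval t := by
  obtain ⟨q, hq⟩ := exists_eval_eq (transvection i j (X : ℂ[X])) (det_transvection_of_ne _ _ h _)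
    (halg w ℓ)
  refine ⟨q, fun t => ?_⟩
  rw [hq (aeval t) (transvectionGL h t), coe_aeval_eq_eval]
  rw [transvection_map, coe_transvectionGL, aeval_X]

/-- A highest weight vector is fixed by the root subgroups whose root is orthogonal to the
highest weight. -/
theorem apply_transvectionGL (ho : Function.Injective o)
    (halg : ∀ w : W, IsRegularMap fun g => ρ g w) {w : W}
    (hw : ∀ b : GL ι ℂ, (b : Matrix ι ι ℂ).BlockTriangular o →
      ρ b w = (∏ i, ((b : Matrix ι ι ℂ) i i) ^ μ i) • w)
    {i j : ι} (h : i ≠ j) (hμ : μ i = μ j) (t : ℂ) : ρ (transvectionGL h t) w = w := by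
  have hpos : ∀ {i j : ι} (h : i ≠ j), o i < o j → ∀ t, ρ (transvectionGL h t) w = w := by
    intro i j h hij t
    rw [hw]
    · rw [Finset.prod_eq_one, one_smul]
      intro k _
      rw [coe_transvectionGL, transvection, Matrix.add_apply, Matrix.single_apply_of_ne]
      · simp
      · rintro ⟨rfl, rfl⟩; exact h rfl
    · exact blockTriangular_transvection hij.le t
  rcases lt_or_gt_of_ne (ho.ne h) with hij | hij
  · exact hpos h hij t
  refine eq_of_forall_dual fun ℓ => ?_
  obtain ⟨P, hP⟩ := exists_polynomial_transvection halg h w ℓ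
  obtain ⟨Q, hQ⟩ := exists_polynomial_transvection halg h.symm (ρ (transvectionGL h 1) w) ℓ
  -- A relation in `SL₂`: the lower element at `u⁻¹`, times the upper triangular `b` below, is the
  -- upper element at `u - 1` times the lower element at `1`. As `b` has diagonal entries `u⁻¹` and
  -- `u` at `i` and `j`, and `μ i = μ j`, it fixes `w`. The matrix coefficient is then polynomial in
  -- both `u` and `u⁻¹`, hence constant.
  have hPQ : ∀ u : ℂ, u ≠ 0 → P.eval u⁻¹ = (Q.comp (X - C 1)).eval u := by
    intro u hu
    rw [eval_comp, eval_sub, eval_X, eval_C, ← hQ, ← hP]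
    congr 1
    set b := (transvectionGL h u⁻¹)⁻¹ * (transvectionGL h.symm (u - 1) * transvectionGL h 1)
      with hb
    have hbm : (b : Matrix ι ι ℂ) =
        transvection i j (-u⁻¹) * (transvection j i (u - 1) * transvection i j 1) := by
      rw [hb, transvectionGL_inv]; rfl
    have entry : ∀ k l, (b : Matrix ι ι ℂ) k l =
        if k = l then (if k = j then u else if k = i then u⁻¹ else 1)
        else if k = j ∧ l = i then u - 1 else 0 := by
      intro k l
      rw [hbm]
      have e1 : ∀ k l, (transvection i j (1 : ℂ)) k l =
          if k = l then 1 else if k = i ∧ l = j then 1 else 0 := by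
        intro k l
        rw [transvection, Matrix.add_apply, one_apply, Matrix.single_apply]
        grind
      have e2 : ∀ k l, (transvection j i (u - 1) * transvection i j (1 : ℂ)) k l =
          if k = l then (if k = j then u else 1) else if k = i ∧ l = j then 1 else
            if k = j ∧ l = i then u - 1 else 0 := by
        intro k l
        by_cases hk : k = j
        · subst hk
          rw [transvection_mul_apply_same, e1, e1]
          grind
        · rw [transvection_mul_apply_of_ne _ _ _ _ hk, e1]
          grind
      by_cases hk : k = i
      · subst hk
        rw [transvection_mul_apply_same, e2, e2]
        have := inv_mul_cancel₀ hu
        grind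
      · rw [transvection_mul_apply_of_ne _ _ _ _ hk, e2]
        grind
    have hbw : ρ b w = w := by
      rw [hw b]
      · rw [Finset.prod_eq_mul i j h]
        · simp only [entry, if_true, if_neg h, hμ]
          rw [← mul_zpow, inv_mul_cancel₀ hu, _root_.one_zpow, one_smul]
        · rintro k - ⟨hki, hkj⟩
          simp [entry, hki, hkj]
        · simp
        · simp
      · intro k l hkl
        rw [entry]
        rw [if_neg (by rintro rfl; exact lt_irrefl _ hkl), if_neg]
        rintro ⟨rfl, rfl⟩
        exact lt_asymm hkl hij
    have : transvectionGL h u⁻¹ * b = transvectionGL h.symm (u - 1) * transvectionGL h 1 := by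
      rw [hb, mul_inv_cancel_left]
    conv_lhs => rw [← hbw]
    rw [← Module.End.mul_apply, ← map_mul, this, map_mul, Module.End.mul_apply]
  have h0 : transvectionGL h 0 = 1 := by
    apply Units.ext
    simp [coe_transvectionGL]
  rw [hP, eval_eq_of_eval_inv hPQ, ← hP, h0, map_one, Module.End.one_apply]

/-- If a subgroup `GL(κ)` acts on a vector through elementary matrices trivially, and through
diagonal matrices by a power of the determinant, then it acts by this power. -/
theorem apply_eq_detPow_smul {κ : Type*} [Fintype κ] [DecidableEq κ] (Φ : GL κ ℂ →* GL ι ℂ)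
    {w : W} {e : ℤ}
    (hdiag : ∀ t : κ → ℂˣ, ρ (Φ (diagTorus t)) w = (∏ i, (t i : ℂ) ^ e) • w)
    (htrans : ∀ {i j : κ} (h : i ≠ j) (t : ℂ), ρ (Φ (transvectionGL h t)) w = w)
    (g : GL κ ℂ) : ρ (Φ g) w = detPow e g • w := by
  refine diagonal_transvection_induction_of_det_ne_zero
    (fun M => ∀ g : GL κ ℂ, (g : Matrix κ κ ℂ) = M → ρ (Φ g) w = detPow e g • w)
    (g : Matrix κ κ ℂ) (Matrix.isUnits_det_units g).ne_zero ?_ ?_ ?_ g rfl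
  · intro D hD g hg
    rw [det_diagonal, Finset.prod_ne_zero_iff] at hD
    have : g = diagTorus fun i => Units.mk0 (D i) (hD i (Finset.mem_univ i)) := by
      apply Units.ext
      rw [hg]; rfl
    rw [this, hdiag]
    simp [detPow, diagTorus, Finset.prod_zpow]
  · intro t g hg
    have : g = transvectionGL t.hij t.c := by
      apply Units.ext
      rw [hg]; rfl
    rw [this, htrans]
    simp [detPow, coe_transvectionGL, det_transvection_of_ne _ _ t.hij]
  · intro A B hA hB ihA ihB g hg
    have : g = GeneralLinearGroup.mkOfDetNeZero A hA * GeneralLinearGroup.mkOfDetNeZero B hB := by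
      apply Units.ext
      rw [hg]; rfl
    have hA' := ihA (GeneralLinearGroup.mkOfDetNeZero A hA) rfl
    have hB' := ihB (GeneralLinearGroup.mkOfDetNeZero B hB) rfl
    rw [this, map_mul, map_mul, Module.End.mul_apply, hB', map_smul, hA', smul_smul]
    simp only [detPow, Units.val_mul, det_mul, mul_zpow]
    rw [mul_comm]

end General

end BCSpherical

/-! ### Block matrices, the big cell, and the line `W̃`. -/

namespace BCSpherical

open Matrix Polynomial

section BlockDiag

variable {ι₁ ι₂ : Type*} [Fintype ι₁] [DecidableEq ι₁] [Fintype ι₂] [DecidableEq ι₂]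

theorem coe_blockDiag (a : GL ι₁ ℂ) (b : GL ι₂ ℂ) :
    (blockDiag a b : Matrix (ι₁ ⊕ ι₂) (ι₁ ⊕ ι₂) ℂ) =
      fromBlocks (a : Matrix ι₁ ι₁ ℂ) 0 0 (b : Matrix ι₂ ι₂ ℂ) := rfl

theorem blockDiag_mul (a a' : GL ι₁ ℂ) (b b' : GL ι₂ ℂ) :
    blockDiag a b * blockDiag a' b' = blockDiag (a * a') (b * b') := by
  apply Units.ext
  simp [coe_blockDiag, fromBlocks_multiply]

theorem blockDiag_one : blockDiag (1 : GL ι₁ ℂ) (1 : GL ι₂ ℂ) = 1 := by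
  apply Units.ext
  simp [coe_blockDiag]

/-- The block diagonal embedding of a product of general linear groups. -/
def blockDiagHom (ι₁ ι₂ : Type*) [Fintype ι₁] [DecidableEq ι₁] [Fintype ι₂] [DecidableEq ι₂] :
    GL ι₁ ℂ × GL ι₂ ℂ →* GL (ι₁ ⊕ ι₂) ℂ where
  toFun g := blockDiag g.1 g.2
  map_one' := blockDiag_one
  map_mul' _ _ := (blockDiag_mul _ _ _ _).symm

theorem blockDiag_diagTorus (t : ι₁ → ℂˣ) (t' : ι₂ → ℂˣ) :
    blockDiag (diagTorus t) (diagTorus t') = diagTorus (Sum.elim t t') := by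
  apply Units.ext
  ext i j
  rcases i with i | i <;> rcases j with j | j <;>
    simp [coe_blockDiag, diagTorus, diagonal_apply]

theorem diagTorus_one : diagTorus (fun _ => 1 : ι₁ → ℂˣ) = 1 := by
  apply Units.ext
  simp [diagTorus]

theorem blockDiag_transvectionGL_left {i j : ι₁} (h : i ≠ j) (t : ℂ) :
    blockDiag (transvectionGL h t) (1 : GL ι₂ ℂ) =
      transvectionGL (Sum.inl_injective.ne h) t := by
  apply Units.ext
  ext i j
  rcases i with i | i <;> rcases j with j | j <;>
    simp [coe_blockDiag, coe_transvectionGL, transvection, single_apply, one_apply]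

theorem blockDiag_transvectionGL_right {i j : ι₂} (h : i ≠ j) (t : ℂ) :
    blockDiag (1 : GL ι₁ ℂ) (transvectionGL h t) =
      transvectionGL (Sum.inr_injective.ne h) t := by
  apply Units.ext
  ext i j
  rcases i with i | i <;> rcases j with j | j <;>
    simp [coe_blockDiag, coe_transvectionGL, transvection, single_apply, one_apply]

/-- Block upper triangular unipotent matrices. -/
def upperGL (B : Matrix ι₁ ι₂ ℂ) : GL (ι₁ ⊕ ι₂) ℂ where
  val := fromBlocks 1 B 0 1
  inv := fromBlocks 1 (-B) 0 1
  val_inv := by simp [fromBlocks_multiply]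
  inv_val := by simp [fromBlocks_multiply]

/-- Block lower triangular unipotent matrices. -/
def lowerGL (C : Matrix ι₂ ι₁ ℂ) : GL (ι₁ ⊕ ι₂) ℂ where
  val := fromBlocks 1 0 C 1
  inv := fromBlocks 1 0 (-C) 1
  val_inv := by simp [fromBlocks_multiply]
  inv_val := by simp [fromBlocks_multiply]

theorem coe_lowerGL (C : Matrix ι₂ ι₁ ℂ) :
    (lowerGL C : Matrix (ι₁ ⊕ ι₂) (ι₁ ⊕ ι₂) ℂ) = fromBlocks 1 0 C 1 := rfl

theorem lowerGL_zero : lowerGL (0 : Matrix ι₂ ι₁ ℂ) = 1 := by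
  apply Units.ext
  simp [coe_lowerGL]

/-- Block LDU factorisation through the Schur complement. -/
theorem exists_eq_lower_mul_blockDiag_mul_upper (g : GL (ι₁ ⊕ ι₂) ℂ)
    (hg : (g : Matrix (ι₁ ⊕ ι₂) (ι₁ ⊕ ι₂) ℂ).toBlocks₁₁.det ≠ 0) :
    ∃ C a b B, g = lowerGL C * blockDiag a b * upperGL B := by
  set A := (g : Matrix (ι₁ ⊕ ι₂) (ι₁ ⊕ ι₂) ℂ).toBlocks₁₁
  set B := (g : Matrix (ι₁ ⊕ ι₂) (ι₁ ⊕ ι₂) ℂ).toBlocks₁₂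
  set C := (g : Matrix (ι₁ ⊕ ι₂) (ι₁ ⊕ ι₂) ℂ).toBlocks₂₁
  set D := (g : Matrix (ι₁ ⊕ ι₂) (ι₁ ⊕ ι₂) ℂ).toBlocks₂₂
  let : Invertible A := invertibleOfIsUnitDet A (isUnit_iff_ne_zero.2 hg)
  have hgb : (g : Matrix (ι₁ ⊕ ι₂) (ι₁ ⊕ ι₂) ℂ) = fromBlocks A B C D :=
    (fromBlocks_toBlocks _).symm
  have hdet : (D - C * ⅟A * B).det ≠ 0 := by
    have h := (Matrix.isUnits_det_units g).ne_zero
    rw [hgb, det_fromBlocks₁₁] at h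
    exact right_ne_zero_of_mul h
  refine ⟨C * ⅟A, GeneralLinearGroup.mkOfDetNeZero A hg,
    GeneralLinearGroup.mkOfDetNeZero _ hdet, ⅟A * B, Units.ext ?_⟩
  rw [hgb, fromBlocks_eq_of_invertible₁₁]
  rfl

/-- As `s → 0` this conjugation contracts the lower unipotent group to the identity; `subW_eq_span`
rests on it. -/
theorem blockDiag_one_mul_lowerGL (s : ℂˣ) (C : Matrix ι₂ ι₁ ℂ) :
    blockDiag (1 : GL ι₁ ℂ) (diagTorus fun _ => s) * lowerGL C =
      lowerGL ((s : ℂ) • C) * blockDiag 1 (diagTorus fun _ => s) := by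
  apply Units.ext
  simp only [Units.val_mul, coe_blockDiag, coe_lowerGL, fromBlocks_multiply]
  simp [diagTorus, smul_eq_diagonal_mul]

theorem detPow_ne_zero (e : ℤ) (g : GL ι₁ ℂ) : detPow e g ≠ 0 :=
  zpow_ne_zero _ (Matrix.isUnits_det_units g).ne_zero

theorem detPow_one (e : ℤ) : detPow e (1 : GL ι₁ ℂ) = 1 := by simp [detPow]

theorem detPow_diagTorus (e : ℤ) (t : ι₁ → ℂˣ) :
    detPow e (diagTorus t) = ∏ i, (t i : ℂ) ^ e := by
  simp [detPow, diagTorus, Finset.prod_zpow]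

end BlockDiag

namespace Param

variable {c : Param} {n p : ℕ} {W : Type*} [AddCommGroup W] [Module ℂ W]
  {ρ : Representation ℂ (GL (Idx₁ n p) ℂ) W}

/-- The highest weight vector of `W` spans a one-dimensional representation of the parabolic
subgroup with Levi factor `GL(n) × GL(p)`. -/
theorem IsW.exists_parabolic_vector (hρ : c.IsW ρ) : ∃ w : W, w ≠ 0 ∧
    (∀ a b, ρ (blockDiag a b) w = (detPow c.kt₁ a * detPow c.k₁ b) • w) ∧
    ∀ B, ρ (upperGL B) w = w := by
  obtain ⟨w, hw0, hw⟩ := hρ.highest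
  have hT : ∀ t : Idx₁ n p → ℂˣ, ρ (diagTorus t) w = (∏ i, (t i : ℂ) ^ c.weightW n p i) • w := by
    intro t
    rw [hw]
    · simp [diagTorus]
    · exact blockTriangular_diagonal _
  refine ⟨w, hw0, fun a b => ?_, fun B => ?_⟩
  · have ha : ∀ a, ρ (blockDiag a 1) w = detPow c.kt₁ a • w := by
      refine apply_eq_detPow_smul ((blockDiagHom (Fin n) (Fin p)).comp (MonoidHom.inl _ _)) ?_ ?_
      · intro t
        change ρ (blockDiag (diagTorus t) 1) w = _
        rw [← diagTorus_one, blockDiag_diagTorus, hT]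
        simp [weightW]
      · intro i j h t
        change ρ (blockDiag (transvectionGL h t) 1) w = _
        rw [blockDiag_transvectionGL_left]
        exact apply_transvectionGL toLex.injective hρ.algebraic hw (Sum.inl_injective.ne h) rfl t
    have hb : ∀ b, ρ (blockDiag 1 b) w = detPow c.k₁ b • w := by
      refine apply_eq_detPow_smul ((blockDiagHom (Fin n) (Fin p)).comp (MonoidHom.inr _ _)) ?_ ?_
      · intro t
        change ρ (blockDiag 1 (diagTorus t)) w = _
        rw [← diagTorus_one, blockDiag_diagTorus, hT]
        simp [weightW]
      · intro i j h t
        change ρ (blockDiag 1 (transvectionGL h t)) w = _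
        rw [blockDiag_transvectionGL_right]
        exact apply_transvectionGL toLex.injective hρ.algebraic hw (Sum.inr_injective.ne h) rfl t
    rw [← mul_one a, ← one_mul b, ← blockDiag_mul, map_mul, Module.End.mul_apply, hb, map_smul,
      ha, smul_smul, mul_one, one_mul, mul_comm]
  · rw [hw]
    · simp [upperGL]
    · intro i j hij
      rcases i with i | i <;> rcases j with j | j
      · have : i ≠ j := by rintro rfl; exact lt_irrefl _ hij
        simp [upperGL, this]
      · exact absurd hij (by simp)
      · simp [upperGL]
      · have : i ≠ j := by rintro rfl; exact lt_irrefl _ hij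
        simp [upperGL, this]

/-- On the big cell the outer factors act on `w` by scalars, so the vanishing is immediate there. It
extends to all `g` by density, tested on the line `u ↦ u + g`. -/
theorem dual_eq_zero_of_lowerGL (hρ : c.IsW ρ) {w : W}
    (hL : ∀ a b, ρ (blockDiag a b) w = (detPow c.kt₁ a * detPow c.k₁ b) • w)
    (hU : ∀ B, ρ (upperGL B) w = w) {ℓ : Module.Dual ℂ W} (hℓ : ∀ C, ℓ (ρ (lowerGL C) w) = 0)
    (g : GL (Idx₁ n p) ℂ) : ℓ (ρ g w) = 0 := by
  have hcell : ∀ g : GL (Idx₁ n p) ℂ, (g : Matrix (Idx₁ n p) (Idx₁ n p) ℂ).toBlocks₁₁.det ≠ 0 →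
      ℓ (ρ g w) = 0 := by
    intro g hg
    obtain ⟨C, a, b, B, rfl⟩ := exists_eq_lower_mul_blockDiag_mul_upper g hg
    simp only [map_mul, Module.End.mul_apply, hU, hL, map_smul, hℓ, smul_zero]
  -- The characteristic matrix of `-g` is `X + g`. Its determinant and that of its upper left block
  -- are monic in `X`, so only finitely many `u` leave the group or the big cell.
  obtain ⟨k, q, hq⟩ := exists_det_pow_mul_eq
    (charmatrix (-(g : Matrix (Idx₁ n p) (Idx₁ n p) ℂ))) (hρ.algebraic w ℓ)
  have hmap : ∀ u : ℂ, (charmatrix (-(g : Matrix (Idx₁ n p) (Idx₁ n p) ℂ))).map (aeval u) =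
      scalar _ u - -(g : Matrix (Idx₁ n p) (Idx₁ n p) ℂ) := by
    intro u
    ext i j
    by_cases hij : i = j
    · subst hij; simp
    · simp [hij]
  have hq0 : q = 0 := by
    have h : q * (-(g : Matrix (Idx₁ n p) (Idx₁ n p) ℂ)).charpoly *
        (-(g : Matrix (Idx₁ n p) (Idx₁ n p) ℂ).toBlocks₁₁).charpoly = 0 := by
      apply Polynomial.funext
      intro u
      rw [eval_mul, eval_mul, eval_charpoly, eval_charpoly, eval_zero]
      by_cases h1 : (scalar _ u - -(g : Matrix (Idx₁ n p) (Idx₁ n p) ℂ)).det = 0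
      · rw [h1, mul_zero, zero_mul]
      by_cases h2 : (scalar _ u - -(g : Matrix (Idx₁ n p) (Idx₁ n p) ℂ).toBlocks₁₁).det = 0
      · rw [h2, mul_zero]
      have h3 := hq (aeval u) (GeneralLinearGroup.mkOfDetNeZero _ h1) (hmap u).symm
      rw [hcell, mul_zero, coe_aeval_eq_eval] at h3
      · rw [← h3, zero_mul, zero_mul]
      · convert h2 using 2
        ext i j
        simp [GeneralLinearGroup.mkOfDetNeZero, toBlocks₁₁, diagonal_apply]
    rcases mul_eq_zero.1 h with h | h
    · exact (mul_eq_zero.1 h).resolve_right (charpoly_monic _).ne_zero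
    · exact absurd h (charpoly_monic _).ne_zero
  have h0 := hq (aeval 0) g (by rw [hmap]; simp)
  rw [hq0, map_zero] at h0
  exact (mul_eq_zero.1 h0).resolve_left
    (pow_ne_zero _ (Matrix.isUnits_det_units g).ne_zero)

/-- By irreducibility the full orbit of `w` spans `W`, and a functional vanishing on the lower
unipotent orbit vanishes on the full one. -/
theorem span_lowerGL_eq_top (hρ : c.IsW ρ) {w : W} (hw : w ≠ 0)
    (hL : ∀ a b, ρ (blockDiag a b) w = (detPow c.kt₁ a * detPow c.k₁ b) • w)
    (hU : ∀ B, ρ (upperGL B) w = w) :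
    Submodule.span ℂ (Set.range fun C => ρ (lowerGL C) w) = ⊤ := by
  let T : Subrepresentation ρ :=
    { toSubmodule := Submodule.span ℂ (Set.range fun g => ρ g w)
      apply_mem_toSubmodule := by
        intro g v hv
        induction hv using Submodule.span_induction with
        | mem v hv =>
          obtain ⟨h, rfl⟩ := hv
          exact Submodule.subset_span ⟨g * h, by simp⟩
        | zero => simp
        | add v v' _ _ h h' => rw [map_add]; exact Submodule.add_mem _ h h'
        | smul z v _ h => rw [map_smul]; exact Submodule.smul_mem _ _ h }
  have hwT : w ∈ T.toSubmodule := Submodule.subset_span ⟨1, by simp⟩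
  have : ρ.IsIrreducible := hρ.irreducible
  have hT : T = ⊤ := by
    refine (eq_bot_or_eq_top T).resolve_left fun h => hw ?_
    rw [h] at hwT
    exact (Submodule.mem_bot ℂ).1 hwT
  rw [eq_top_iff]
  intro v _
  by_contra hv
  obtain ⟨ℓ, hℓv, hℓ⟩ := Submodule.exists_le_ker_of_notMem hv
  have hker : T.toSubmodule ≤ LinearMap.ker ℓ := by
    rw [Submodule.span_le]
    rintro _ ⟨g, rfl⟩
    exact dual_eq_zero_of_lowerGL hρ hL hU
      (fun C => hℓ (Submodule.subset_span ⟨C, rfl⟩)) g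
  have hvT : v ∈ T.toSubmodule := by rw [hT]; trivial
  exact hℓv (hker hvT)

/-- The subspace `W̃` is the highest weight space. -/
theorem subW_eq_span (hρ : c.IsW ρ) {w : W} (hw : w ≠ 0)
    (hL : ∀ a b, ρ (blockDiag a b) w = (detPow c.kt₁ a * detPow c.k₁ b) • w)
    (hU : ∀ B, ρ (upperGL B) w = w) : c.subW ρ = Submodule.span ℂ {w} := by
  apply le_antisymm
  · intro v hv
    -- Up to the character `det^{ϰ₍₁₎}`, the scalars `s` of `GL(p)` act on `v` polynomially in `s`,
    -- and the limit at `s = 0` is a multiple of `w`. The scalar `z` must not depend on `ℓ`.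
    have key : ∀ v : W, ∃ z : ℂ, ∀ ℓ : Module.Dual ℂ W, ∃ P : ℂ[X],
        (∀ s : ℂˣ, ℓ (ρ (blockDiag 1 (diagTorus fun _ => s)) v) =
          detPow c.k₁ (diagTorus fun _ : Fin p => s) * P.eval (s : ℂ)) ∧
        P.eval 0 = z * ℓ w := by
      intro v
      have hv : v ∈ Submodule.span ℂ (Set.range fun C => ρ (lowerGL C) w) := by
        rw [span_lowerGL_eq_top hρ hw hL hU]; trivial
      induction hv using Submodule.span_induction with
      | mem v hv =>
        obtain ⟨C, rfl⟩ := hv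
        refine ⟨1, fun ℓ => ?_⟩
        obtain ⟨q, hq⟩ := exists_eval_eq
          (fromBlocks 1 0 ((X : ℂ[X]) • C.map (Polynomial.C : ℂ →+* ℂ[X])) 1 :
            Matrix (Idx₁ n p) (Idx₁ n p) ℂ[X]) (by simp) (hρ.algebraic w ℓ)
        have hq' : ∀ s : ℂ, ℓ (ρ (lowerGL (s • C)) w) = q.eval s := by
          intro s
          rw [hq (aeval s), coe_aeval_eq_eval]
          rw [coe_lowerGL, fromBlocks_map]
          congr 1
          · simp [Matrix.map_one]
          · simp
          · ext i j
            simp only [map_apply, Matrix.smul_apply, smul_eq_mul, map_mul, aeval_X, aeval_C]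
            rfl
          · simp [Matrix.map_one]
        refine ⟨q, fun s => ?_, ?_⟩
        · rw [← Module.End.mul_apply, ← map_mul, blockDiag_one_mul_lowerGL, map_mul,
            Module.End.mul_apply, hL, map_smul, map_smul, hq', detPow_one, one_mul, smul_eq_mul]
        · rw [← hq', zero_smul, lowerGL_zero, map_one, Module.End.one_apply, one_mul]
      | zero => exact ⟨0, fun ℓ => ⟨0, fun s => by simp, by simp⟩⟩
      | add v v' _ _ h h' =>
        obtain ⟨z, h⟩ := h
        obtain ⟨z', h'⟩ := h'
        refine ⟨z + z', fun ℓ => ?_⟩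
        obtain ⟨P, h1, h2⟩ := h ℓ
        obtain ⟨P', h1', h2'⟩ := h' ℓ
        refine ⟨P + P', fun s => ?_, ?_⟩
        · rw [map_add, map_add, h1, h1', eval_add, mul_add]
        · rw [eval_add, h2, h2', add_mul]
      | smul y v _ h =>
        obtain ⟨z, h⟩ := h
        refine ⟨y * z, fun ℓ => ?_⟩
        obtain ⟨P, h1, h2⟩ := h ℓ
        refine ⟨Polynomial.C y * P, fun s => ?_, ?_⟩
        · rw [map_smul, map_smul, h1, eval_mul, eval_C, smul_eq_mul]; ring
        · rw [eval_mul, eval_C, h2, mul_assoc]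
    obtain ⟨z, hz⟩ := key v
    rw [Submodule.mem_span_singleton]
    refine ⟨z, eq_of_forall_dual fun ℓ => ?_⟩
    obtain ⟨P, h1, h2⟩ := hz ℓ
    -- For `v` in `W̃` the rescaled action is constant in `s`, so `v` equals its own limit.
    have hP : P = Polynomial.C (ℓ v) := by
      apply Polynomial.eq_of_infinite_eval_eq
      apply Set.Infinite.mono (s := {0}ᶜ)
      · intro u hu
        have h := h1 (Units.mk0 u hu)
        rw [hv, map_smul, smul_eq_mul] at h
        have := mul_left_cancel₀ (detPow_ne_zero _ _) h
        rw [Set.mem_ofPred_eq, eval_C]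
        exact this.symm
      · exact (Set.finite_singleton _).infinite_compl
    rw [map_smul, smul_eq_mul, ← h2, hP, eval_C]
  · rw [Submodule.span_singleton_le_iff_mem]
    intro y
    rw [hL, detPow_one, one_mul]

end Param

end BCSpherical

/-! ### The line `Ṽ`, and the values of spherical functions on `A`. -/

namespace BCSpherical

open Matrix
open scoped TensorProduct

section Symmetric

variable {n : ℕ}

theorem coeff_linSubst_diagonal (t : Fin n → ℂ) (q : MvPolynomial (Fin n) ℂ) (α : Fin n →₀ ℕ) :
    (linSubst (diagonal t) q).coeff α = (∏ i, t i ^ α i) * q.coeff α := by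
  have hX : ∀ j, ∑ i, diagonal t i j • (MvPolynomial.X i : MvPolynomial (Fin n) ℂ) =
      MvPolynomial.C (t j) * MvPolynomial.X j := by
    intro j
    rw [Finset.sum_eq_single j]
    · rw [diagonal_apply_eq, MvPolynomial.smul_eq_C_mul]
    · intro i _ hij
      rw [diagonal_apply_ne _ hij, zero_smul]
    · simp
  induction q using MvPolynomial.induction_on' with
  | monomial β a =>
    have : linSubst (diagonal t) (MvPolynomial.monomial β a) =
        MvPolynomial.monomial β ((∏ i, t i ^ β i) * a) := by
      rw [linSubst, MvPolynomial.aeval_monomial, Finsupp.prod_fintype _ _ (fun i => pow_zero _),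
        MvPolynomial.monomial_eq (s := β), Finsupp.prod_fintype _ _ (fun i => pow_zero _)]
      simp only [hX, mul_pow, Finset.prod_mul_distrib, MvPolynomial.algebraMap_eq, map_mul,
        map_prod, map_pow]
      ring
    rw [this, MvPolynomial.coeff_monomial, MvPolynomial.coeff_monomial]
    split_ifs with h
    · rw [h]
    · rw [mul_zero]
  | add p q hp hq => rw [map_add, MvPolynomial.coeff_add, hp, hq, MvPolynomial.coeff_add, mul_add]

end Symmetric

namespace Param

variable (c : Param) (n : ℕ)

theorem prod_X_pow_mem : ∏ i, (MvPolynomial.X i : MvPolynomial (Fin n) ℂ) ^ c.kv ∈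
    MvPolynomial.homogeneousSubmodule (Fin n) ℂ (c.kv * n) := by
  rw [MvPolynomial.mem_homogeneousSubmodule]
  have := MvPolynomial.IsHomogeneous.prod Finset.univ
    (fun i => (MvPolynomial.X i : MvPolynomial (Fin n) ℂ) ^ c.kv) (fun _ => c.kv)
    (fun i _ => by simpa using (MvPolynomial.isHomogeneous_X ℂ i).pow c.kv)
  simpa [mul_comm] using this

/-- The vector `(X_1 ⋯ X_n)^{ϰ_v}` of `V`. -/
noncomputable def weightVec : c.V n :=
  ⟨∏ i, (MvPolynomial.X i : MvPolynomial (Fin n) ℂ) ^ c.kv, c.prod_X_pow_mem n⟩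

theorem weightVec_eq_monomial : (c.weightVec n : MvPolynomial (Fin n) ℂ) =
    MvPolynomial.monomial (Finsupp.equivFunOnFinite.symm fun _ => c.kv) 1 := by
  rw [MvPolynomial.monomial_eq, Finsupp.prod_fintype _ _ (fun i => pow_zero _)]
  simp [weightVec]

theorem weightVec_ne_zero : c.weightVec n ≠ 0 := by
  rw [Ne, ← Submodule.coe_eq_zero, weightVec_eq_monomial, MvPolynomial.monomial_eq_zero]
  exact one_ne_zero

variable {n}

theorem coe_repV (g : GL (Fin n) ℂ) (v : c.V n) :
    (c.repV n g v : MvPolynomial (Fin n) ℂ) =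
      detPow (-(c.kv : ℤ) + (c.k₂ + c.k₁ - c.kt₁)) g •
        linSubst (g : Matrix (Fin n) (Fin n) ℂ) (v : MvPolynomial (Fin n) ℂ) := rfl

theorem coeff_repV_diagTorus (t : Fin n → ℂˣ) (v : c.V n) (α : Fin n →₀ ℕ) :
    (c.repV n (diagTorus t) v : MvPolynomial (Fin n) ℂ).coeff α =
      (∏ i, (t i : ℂ) ^ (-(c.kv : ℤ) + (c.k₂ + c.k₁ - c.kt₁))) * ((∏ i, (t i : ℂ) ^ α i) *
        (v : MvPolynomial (Fin n) ℂ).coeff α) := by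
  rw [coe_repV, MvPolynomial.coeff_smul, smul_eq_mul, detPow_diagTorus,
    ← coeff_linSubst_diagonal]
  rfl

theorem subV_eq_span : c.subV n = Submodule.span ℂ {c.weightVec n} := by
  apply le_antisymm
  · intro v hv
    rw [Submodule.mem_span_singleton]
    refine ⟨(v : MvPolynomial (Fin n) ℂ).coeff (Finsupp.equivFunOnFinite.symm fun _ => c.kv), ?_⟩
    apply Subtype.ext
    ext α
    rw [Submodule.coe_smul, MvPolynomial.coeff_smul, weightVec_eq_monomial,
      MvPolynomial.coeff_monomial, smul_eq_mul]
    split_ifs with h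
    · rw [h, mul_one]
    rw [mul_zero]
    by_contra h0
    apply h
    ext i
    -- The torus element with a single entry 2 in place `i` detects the exponent `α i`.
    have h1 := congrArg (fun q : c.V n => (q : MvPolynomial (Fin n) ℂ).coeff α)
      (hv (Function.update 1 i (Units.mk0 2 two_ne_zero)))
    simp only [coeff_repV_diagTorus, Submodule.coe_smul, MvPolynomial.coeff_smul, smul_eq_mul]
      at h1
    rw [← mul_assoc] at h1
    have h2 := mul_right_cancel₀ (Ne.symm h0) h1
    have hprod : ∀ e : Fin n → ℤ,
        ∏ j, ((Function.update (1 : Fin n → ℂˣ) i (Units.mk0 2 two_ne_zero) j : ℂˣ) : ℂ) ^ e j =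
          2 ^ e i := by
      intro e
      rw [Finset.prod_eq_single i]
      · simp
      · intro j _ hj
        simp [hj]
      · simp
    have hprod' := hprod fun j => (α j : ℤ)
    simp only [zpow_natCast] at hprod'
    rw [hprod fun _ => _, hprod fun _ => _, hprod', ← zpow_natCast, ← zpow_add₀ two_ne_zero] at h2
    -- Norms reduce the comparison to real powers of 2, where the exponent is determined.
    have h3 := congrArg norm h2
    rw [norm_zpow, norm_zpow, Complex.norm_two] at h3
    have h4 := zpow_right_injective₀ (G₀ := ℝ) two_pos (by norm_num) h3
    simp only [Finsupp.equivFunOnFinite_symm_apply_apply]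
    omega
  · rw [Submodule.span_singleton_le_iff_mem]
    intro t
    apply Subtype.ext
    ext α
    rw [coeff_repV_diagTorus, Submodule.coe_smul, MvPolynomial.coeff_smul, weightVec_eq_monomial,
      MvPolynomial.coeff_monomial, smul_eq_mul]
    split_ifs with h
    · subst h
      rw [← mul_assoc, ← Finset.prod_mul_distrib]
      congr 1
      refine Finset.prod_congr rfl fun i _ => ?_
      rw [← zpow_natCast, ← zpow_add₀ (t i).ne_zero]
      congr 1
      simp only [Finsupp.equivFunOnFinite_symm_apply_apply]
      ring
    · simp

/-- Evaluation of the elements of `V` at a point. -/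
noncomputable def evalV (e : Fin n → ℂ) : Module.Dual ℂ (c.V n) :=
  (MvPolynomial.aeval e).toLinearMap ∘ₗ Submodule.subtype _

theorem evalV_repV_weightVec (e : Fin n → ℂ) (g : GL (Fin n) ℂ) :
    c.evalV e (c.repV n g (c.weightVec n)) =
      detPow (-(c.kv : ℤ) + (c.k₂ + c.k₁ - c.kt₁)) g *
        ∏ j, (∑ i, (g : Matrix (Fin n) (Fin n) ℂ) i j * e i) ^ c.kv := by
  change MvPolynomial.aeval e (c.repV n g (c.weightVec n) : MvPolynomial (Fin n) ℂ) = _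
  rw [coe_repV, map_smul, smul_eq_mul]
  simp [weightVec, linSubst]

variable {c} {p : ℕ} {W : Type*} [AddCommGroup W] [Module ℂ W]
  {ρ : Representation ℂ (GL (Idx₁ n p) ℂ) W}

theorem subU_eq_span {w : W} (hW : c.subW ρ = Submodule.span ℂ {w}) :
    c.subU ρ = Submodule.span ℂ {w ⊗ₜ[ℂ] c.weightVec n} := by
  rw [subU, TensorProduct.range_mapIncl, hW, subV_eq_span, Submodule.map₂_span_span,
    Set.image2_singleton]
  rfl

/-- With `commute_expA_right`, this supplies the elements of `K` that can be moved across
`e^{a(x)}`, so that both equivariance laws of `f` constrain a single value. -/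
theorem commute_expA_torus (t : Fin n → ℂˣ) (x : Fin n → ℂ) :
    blockDiag (blockDiag (diagTorus t) 1) (diagTorus t) * expA p x =
      expA p x * blockDiag (blockDiag (diagTorus t) 1) (diagTorus t) := by
  have h : (blockDiag (blockDiag (diagTorus t) (1 : GL (Fin p) ℂ)) (diagTorus t) :
      Matrix (Idx n p) (Idx n p) ℂ) = diagBlocks (fun i => (t i : ℂ)) 0 0 (fun i => (t i : ℂ)) := by
    ext i j
    rcases i with (i | i) | i <;> rcases j with (j | j) | j <;>
      simp [coe_blockDiag, diagTorus, diagBlocks, Matrix.fromBlocks]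
  apply Units.ext
  rw [Units.val_mul, Units.val_mul, h, coe_expA, diagBlocks_mul, diagBlocks_mul]
  congr 1 <;> simp [mul_comm]

theorem commute_expA_right (y : GL (Fin p) ℂ) (x : Fin n → ℂ) :
    blockDiag (blockDiag 1 y) 1 * expA p x = expA p x * blockDiag (blockDiag 1 y) 1 := by
  apply Units.ext
  rw [Units.val_mul, Units.val_mul, coe_expA]
  simp only [coe_blockDiag, diagBlocks, fromBlocks_multiply]
  congr 1
  · simp
  · ext i j; rcases i with i | i <;> simp [mul_apply, Fintype.sum_sum_type, one_apply]
  · ext i j; rcases j with j | j <;> simp [mul_apply, Fintype.sum_sum_type, one_apply]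
  · simp

/-- Restrictions of spherical functions to `A` take values in `Ũ`. -/
theorem IsSpherical.apply_expA_mem {f : GL (Idx n p) ℂ → W ⊗[ℂ] c.V n}
    (hf : c.IsSpherical ρ f) {w : W} (hw : w ≠ 0)
    (hL : ∀ a b, ρ (blockDiag a b) w = (detPow c.kt₁ a * detPow c.k₁ b) • w)
    (hW : c.subW ρ = Submodule.span ℂ {w}) (x : Fin n → ℂ) :
    f (expA p x) ∈ c.subU ρ := by
  -- Contracting the `V` factor commutes with operators on `W`, so every slice of `f(e^{a(x)})`
  -- inherits the `GL(p)` condition and lies in `W̃`.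
  let K : Module.Dual ℂ (c.V n) → W ⊗[ℂ] c.V n →ₗ[ℂ] W := fun ℓ =>
    (TensorProduct.rid ℂ W).toLinearMap ∘ₗ TensorProduct.map LinearMap.id ℓ
  have hK : ∀ ℓ (A : W →ₗ[ℂ] W) u, K ℓ (TensorProduct.map A LinearMap.id u) = A (K ℓ u) := by
    intro ℓ A u
    induction u with
    | zero => simp
    | tmul a b => simp [K]
    | add a b ha hb => rw [map_add, map_add, ha, hb, map_add, map_add]
  have h1 : ∀ ℓ, K ℓ (f (expA p x)) ∈ Submodule.span ℂ {w} := by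
    intro ℓ
    rw [← hW]
    intro y
    have h := hf.left (expA p x) (blockDiag 1 y) 1
    rw [commute_expA_right, hf.right, map_one] at h
    rw [← hK]
    change _ = TensorProduct.map (ρ (blockDiag 1 y)) LinearMap.id (f (expA p x)) at h
    rw [← h, map_smul, detPow_one, mul_one]
    simp [detPow, coe_blockDiag]
  obtain ⟨v, hv⟩ : ∃ v, f (expA p x) = w ⊗ₜ v := by
    let b := Module.Free.chooseBasis ℂ (c.V n)
    have h2 : ∀ i, ∃ z : ℂ, z • w = K (b.coord i) (f (expA p x)) := fun i =>
      Submodule.mem_span_singleton.1 (h1 _)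
    choose z hz using h2
    have h3 : ∀ i, TensorProduct.equivFinsuppOfBasisRight b (f (expA p x)) i = z i • w := by
      intro i
      rw [TensorProduct.equivFinsuppOfBasisRight_apply, hz]
      rfl
    rw [← (TensorProduct.equivFinsuppOfBasisRight b).symm_apply_apply (f (expA p x)),
      TensorProduct.equivFinsuppOfBasisRight_symm_apply, Finsupp.sum]
    refine ⟨∑ i ∈ (TensorProduct.equivFinsuppOfBasisRight b (f (expA p x))).support, z i • b i, ?_⟩
    rw [TensorProduct.tmul_sum]
    refine Finset.sum_congr rfl fun i _ => ?_
    rw [h3, TensorProduct.smul_tmul]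
  -- The torus gives `det(t)^{ϰ₍₁₎+ϰ₍₂₎}` from the right and `det(t)^{ϰ̃₍₁₎}` on `w` from the left;
  -- the quotient is the weight of `v`.
  have hvV : v ∈ c.subV n := by
    intro t
    have h := hf.left (expA p x) (blockDiag (diagTorus t) 1) (diagTorus t)
    obtain ⟨ℓ, hℓ⟩ := Module.Projective.exists_dual_eq_one ℂ hw
    rw [commute_expA_torus, hf.right, hv, TensorProduct.map_tmul, hL] at h
    have h2 := congrArg ((TensorProduct.lid ℂ (c.V n)).toLinearMap ∘ₗ
      TensorProduct.map ℓ LinearMap.id) h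
    have h3 : detPow c.k₁ (blockDiag (diagTorus t) (1 : GL (Fin p) ℂ)) =
        detPow c.k₁ (diagTorus t) := by simp [detPow, coe_blockDiag]
    simp only [map_smul, LinearMap.comp_apply, TensorProduct.map_tmul, hℓ, LinearMap.id_apply,
      LinearEquiv.coe_coe, TensorProduct.lid_tmul, detPow_one, mul_one, one_smul, smul_eq_mul, h3] at h2
    rw [← smul_right_inj (detPow_ne_zero c.kt₁ (diagTorus t)), ← h2, smul_smul,
      ← detPow_diagTorus]
    congr 1
    have hd : (diagTorus t : Matrix (Fin n) (Fin n) ℂ).det ≠ 0 :=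
      (Matrix.isUnits_det_units _).ne_zero
    rw [detPow, detPow, detPow, detPow, ← zpow_add₀ hd, ← zpow_add₀ hd]
    congr 1
    ring
  have hwW : w ∈ c.subW ρ := by
    rw [hW]
    exact Submodule.mem_span_singleton_self w
  rw [hv, subU]
  exact ⟨⟨w, hwW⟩ ⊗ₜ ⟨v, hvV⟩, by simp [TensorProduct.mapIncl]⟩

end Param

end BCSpherical

/-! ### The shear matrix and its relation to `e^{a(x)}`. -/

namespace BCSpherical

open Matrix

section Hook

variable {n p : ℕ} {R : Type*} [CommRing R]

/-- A matrix of size `n + p + n` of the form `(A, 0, B; 0, 1, 0; C, 0, D)`. -/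
def hookBlocks (p : ℕ) (A B C D : Matrix (Fin n) (Fin n) R) : Matrix (Idx n p) (Idx n p) R :=
  fromBlocks (fromBlocks A 0 0 1) (fromRows B 0) (fromCols C 0) D

theorem hookBlocks_mul (A B C D A' B' C' D' : Matrix (Fin n) (Fin n) R) :
    hookBlocks p A B C D * hookBlocks p A' B' C' D' =
      hookBlocks p (A * A' + B * C') (A * B' + B * D') (C * A' + D * C') (C * B' + D * D') := by
  ext i j
  rcases i with (i | i) | i <;> rcases j with (j | j) | j <;>
    simp [hookBlocks, mul_apply, Fintype.sum_sum_type, one_apply]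

theorem hookBlocks_one : hookBlocks p (1 : Matrix (Fin n) (Fin n) R) 0 0 1 = 1 := by
  simp [hookBlocks]

theorem hookBlocks_map {S : Type*} [CommRing S] (F : Type*) [FunLike F R S] [RingHomClass F R S]
    (f : F) (A B C D : Matrix (Fin n) (Fin n) R) :
    (hookBlocks p A B C D).map f = hookBlocks p (A.map f) (B.map f) (C.map f) (D.map f) := by
  ext i j
  rcases i with (i | i) | i <;> rcases j with (j | j) | j <;>
    simp [hookBlocks, one_apply, apply_ite f]

/-- The Schur complement of the upper left identity block is `1 + Z - Z = 1`. -/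
theorem det_hookBlocks_shear (Z : Matrix (Fin n) (Fin n) R) :
    (hookBlocks p 1 1 Z (1 + Z)).det = 1 := by
  rw [hookBlocks, fromBlocks_one, det_fromBlocks_one₁₁, fromCols_mul_fromRows]
  simp

/-- The matrix `(1, 0, 1; 0, 1, 0; Z, 0, 1 + Z)`. -/
def shearGL (p : ℕ) (Z : Matrix (Fin n) (Fin n) ℂ) : GL (Idx n p) ℂ where
  val := hookBlocks p 1 1 Z (1 + Z)
  inv := hookBlocks p (1 + Z) (-1) (-Z) 1
  val_inv := by
    rw [hookBlocks_mul, ← hookBlocks_one]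
    congr 1 <;> noncomm_ring
  inv_val := by
    rw [hookBlocks_mul, ← hookBlocks_one]
    congr 1 <;> noncomm_ring

theorem coe_blockDiag_eq_hookBlocks (a b : GL (Fin n) ℂ) :
    (blockDiag (blockDiag a (1 : GL (Fin p) ℂ)) b : Matrix (Idx n p) (Idx n p) ℂ) =
      hookBlocks p (a : Matrix (Fin n) (Fin n) ℂ) 0 0 (b : Matrix (Fin n) (Fin n) ℂ) := by
  simp [coe_blockDiag, hookBlocks]

theorem coe_expA_eq_hookBlocks (x : Fin n → ℂ) :
    (expA p x : Matrix (Idx n p) (Idx n p) ℂ) =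
      hookBlocks p (diagonal fun i => Complex.cosh (x i)) (diagonal fun i => Complex.sinh (x i))
        (diagonal fun i => Complex.sinh (x i)) (diagonal fun i => Complex.cosh (x i)) := by
  rw [coe_expA]
  rfl

theorem det_expA (x : Fin n → ℂ) : (expA p x : Matrix (Idx n p) (Idx n p) ℂ).det = 1 := by
  rw [expA, hElt, ← GeneralLinearGroup.val_det_apply, map_mul, map_mul, map_inv,
    mul_inv_cancel_comm, GeneralLinearGroup.val_det_apply]
  simp [diagTorus, expUnit, ← Finset.prod_mul_distrib, ← Complex.exp_add]

/-- The identity behind the divisibility: after conjugation by an eigenbasis of `Z` and rescaling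
by elements of the two copies of `K`, the element `e^{a(x)}` becomes polynomial in `Z`. -/
theorem shearGL_mul_blockDiag (Z : Matrix (Fin n) (Fin n) ℂ) (h : GL (Fin n) ℂ) (x : Fin n → ℂ)
    (s c : Fin n → ℂˣ) (hs : ∀ i, (s i : ℂ) = Complex.sinh (x i))
    (hc : ∀ i, (c i : ℂ) = Complex.cosh (x i))
    (hZ : Z * (h : Matrix (Fin n) (Fin n) ℂ) =
      (h : Matrix (Fin n) (Fin n) ℂ) * diagonal fun i => Complex.sinh (x i) ^ 2) :
    shearGL p Z * blockDiag (blockDiag (h * diagTorus s⁻¹) 1) (h * diagTorus c⁻¹) =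
      blockDiag (blockDiag (h * diagTorus (s * c)⁻¹) 1) h * expA p x := by
  apply Units.ext
  have hsh : (shearGL p Z : Matrix (Idx n p) (Idx n p) ℂ) = hookBlocks p 1 1 Z (1 + Z) := rfl
  have hd : ∀ t : Fin n → ℂˣ, (diagTorus t : Matrix (Fin n) (Fin n) ℂ) =
    diagonal fun i => (t i : ℂ) := fun _ => rfl
  rw [Units.val_mul, Units.val_mul, hsh, coe_blockDiag_eq_hookBlocks, coe_blockDiag_eq_hookBlocks,
    coe_expA_eq_hookBlocks, hookBlocks_mul, hookBlocks_mul]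
  simp only [Units.val_mul, hd, ← hs, ← hc, Matrix.add_mul, Matrix.one_mul, ← Matrix.mul_assoc,
    Matrix.mul_zero, Matrix.zero_mul, add_zero, zero_add] at hZ ⊢
  rw [hZ]
  simp only [Matrix.mul_assoc, diagonal_mul_diagonal, ← Matrix.mul_add, diagonal_add]
  congr 3 <;> ext i <;> simp only [Pi.inv_apply, Pi.mul_apply, mul_inv, Units.val_mul]
  · simp
  · rw [mul_comm (((s i)⁻¹ : ℂˣ) : ℂ), mul_assoc, Units.inv_mul, mul_one]
  · rw [sq, mul_assoc, Units.mul_inv, mul_one]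
  -- `1 + Z` has eigenvalues `1 + sinh² x_i = cosh² x_i`, which is why the lower right block is `1 +
  -- Z`.
  · have : 1 + (s i : ℂ) ^ 2 = (c i : ℂ) * c i := by
      rw [hs, hc, ← sq, Complex.cosh_sq]; ring
    rw [← one_add_mul, this, mul_assoc, Units.mul_inv, mul_one]

end Hook

/-! ### A bidiagonal matrix and its eigenvectors. -/

section Newton

variable {n : ℕ} {R : Type*} [CommRing R]

/-- The bidiagonal matrix with diagonal `z` and entries `-1` above the diagonal. -/
def bidiag (z : Fin n → R) : Matrix (Fin n) (Fin n) R :=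
  of fun i j => if i = j then z i else if (j : ℕ) = i + 1 then -1 else 0

theorem bidiag_map {S : Type*} [CommRing S] (F : Type*) [FunLike F R S] [RingHomClass F R S]
    (f : F) (z : Fin n → R) : (bidiag z).map f = bidiag fun i => f (z i) := by
  ext i j
  simp only [bidiag, map_apply, of_apply]
  split_ifs <;> simp

/-- The matrix of values of the Newton polynomials, whose columns are eigenvectors of
`bidiag z`. -/
def newton (z : Fin n → R) : Matrix (Fin n) (Fin n) R :=
  of fun i j => ∏ k with k < i, (z k - z j)

/-- Row by row this is the Newton recurrence `N_{i+1} = (z_i - z_j) N_i`. In the last row the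
missing term is harmless, since the product over all `k` contains the factor `z_j - z_j`. -/
theorem bidiag_mul_newton (z : Fin n → R) : bidiag z * newton z = newton z * diagonal z := by
  ext i j
  let P : ℕ → R := fun m => 
    ∏ k ∈ Finset.univ.filter fun k : Fin n => (k : ℕ) < m, (z k - z j)
  have hP : ∀ i : Fin n, P (i + 1) = (z i - z j) * P i := by
    intro i
    have : Finset.univ.filter (fun k : Fin n => (k : ℕ) < i + 1) =
        insert i (Finset.univ.filter fun k : Fin n => (k : ℕ) < i) := by
      ext k
      simp [Fin.ext_iff]
      omega
    simp only [P, this]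
    rw [Finset.prod_insert (by simp)]
  have hPn : P n = 0 := Finset.prod_eq_zero (i := j) (by simp) (sub_self _)
  have hN : ∀ i : Fin n, newton z i j = P i := fun i => rfl
  have hsum : ∑ k : Fin n, (if (k : ℕ) = i + 1 then P k else 0) = P (i + 1) := by
    by_cases hi : (i : ℕ) + 1 < n
    · rw [Finset.sum_eq_single ⟨i + 1, hi⟩]
      · simp
      · intro k _ hk
        rw [if_neg fun h => hk (Fin.ext h)]
      · simp
    · have : (i : ℕ) + 1 = n := by omega
      rw [this, hPn]
      refine Finset.sum_eq_zero fun k _ => if_neg (by omega)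
  have hentry : ∀ k, bidiag z i k * newton z k j =
      (if i = k then z i * P i else 0) - if (k : ℕ) = i + 1 then P k else 0 := by
    intro k
    rw [hN, bidiag, of_apply]
    by_cases h1 : i = k
    · subst h1
      simp
    · simp only [h1, if_false]
      split_ifs <;> ring
  rw [mul_apply, Finset.sum_congr rfl fun k _ => hentry k, Finset.sum_sub_distrib, hsum, hP,
    mul_diagonal, hN, Finset.sum_ite_eq]
  simp only [Finset.mem_univ, if_true]
  ring

theorem det_newton (z : Fin n → R) :
    (newton z).det = ∏ i, ∏ j ∈ Finset.Ioi i, (z i - z j) := by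
  rw [det_of_isUpperTriangular]
  · simp only [newton, of_apply]
    rw [Finset.prod_comm']
    simp
  · intro i j hij
    exact Finset.prod_eq_zero (i := j) (Finset.mem_filter.2 ⟨Finset.mem_univ _, hij⟩) (sub_self _)

theorem newton_apply_of_val_eq_zero (z : Fin n → R) {i : Fin n} (hi : (i : ℕ) = 0) (j : Fin n) :
    newton z i j = 1 := by
  rw [newton, of_apply, Finset.prod_eq_one]
  intro k hk
  simp [Fin.lt_def, hi] at hk

end Newton

/-! ### Laurent polynomials as functions, and the denominator `δ`. -/

section Laurent

variable {n : ℕ}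

theorem evalAt_single (x : Fin n → ℂ) (ν : Fin n → ℤ) (a : ℂ) :
    evalAt x (AddMonoidAlgebra.single ν a) = a * Complex.exp (∑ i, (ν i : ℂ) * x i) := by
  rw [evalAt, AddMonoidAlgebra.lift_single]
  rfl

/-- The Laurent polynomial `sinh x_i`. -/
noncomputable def sinhL (i : Fin n) : LaurentAlg n :=
  AddMonoidAlgebra.single (Pi.single i 1) (1 / 2) -
    AddMonoidAlgebra.single (Pi.single i (-1)) (1 / 2)

/-- The Laurent polynomial `cosh x_i`. -/
noncomputable def coshL (i : Fin n) : LaurentAlg n :=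
  AddMonoidAlgebra.single (Pi.single i 1) (1 / 2) +
    AddMonoidAlgebra.single (Pi.single i (-1)) (1 / 2)

theorem sum_single_mul (x : Fin n → ℂ) (i : Fin n) (a : ℤ) :
    ∑ j, ((Pi.single i a : Fin n → ℤ) j : ℂ) * x j = a * x i := by
  rw [Finset.sum_eq_single i]
  · simp
  · intro j _ hj
    simp [hj]
  · simp

@[simp] theorem evalAt_sinhL (x : Fin n → ℂ) (i : Fin n) :
    evalAt x (sinhL i) = Complex.sinh (x i) := by
  rw [sinhL, map_sub, evalAt_single, evalAt_single, sum_single_mul, sum_single_mul, Complex.sinh]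
  push_cast
  rw [one_mul, neg_one_mul]
  ring

@[simp] theorem evalAt_coshL (x : Fin n → ℂ) (i : Fin n) :
    evalAt x (coshL i) = Complex.cosh (x i) := by
  rw [coshL, map_add, evalAt_single, evalAt_single, sum_single_mul, sum_single_mul, Complex.cosh]
  push_cast
  rw [one_mul, neg_one_mul]
  ring

/-- Distinct exponents give distinct characters of `ℂ^n`, and distinct characters are linearly
independent. -/
theorem eq_zero_of_evalAt {φ : LaurentAlg n} (h : ∀ x, evalAt x φ = 0) : φ = 0 := by
  let χ : (Fin n → ℤ) → (Multiplicative (Fin n → ℂ) →* ℂ) := fun ν =>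
    { toFun := fun x => Complex.exp (∑ i, (ν i : ℂ) * x.toAdd i)
      map_one' := by simp
      map_mul' := fun x y => by simp [mul_add, Finset.sum_add_distrib, Complex.exp_add] }
  have hχ : Function.Injective χ := by
    intro ν ν' hν
    ext i
    -- At a real point the exponents are real, and there `exp` is injective.
    have h1 := DFunLike.congr_fun hν (Multiplicative.ofAdd (Pi.single i 1))
    have h2 : ∀ ν : Fin n → ℤ,
        ∑ j, (ν j : ℂ) * (Pi.single i 1 : Fin n → ℂ) j = ((ν i : ℝ) : ℂ) := by
      intro ν
      rw [Finset.sum_eq_single i]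
      · simp
      · intro j _ hj
        simp [hj]
      · simp
    change Complex.exp (∑ j, (ν j : ℂ) * (Pi.single i 1 : Fin n → ℂ) j) =
      Complex.exp (∑ j, (ν' j : ℂ) * (Pi.single i 1 : Fin n → ℂ) j) at h1
    rw [h2, h2, ← Complex.ofReal_exp, ← Complex.ofReal_exp, Complex.ofReal_inj] at h1
    exact_mod_cast Real.exp_injective h1
  have hind := (linearIndependent_monoidHom (Multiplicative (Fin n → ℂ)) ℂ).comp χ hχ
  rw [linearIndependent_iff] at hind
  apply AddMonoidAlgebra.ext
  apply hind
  ext x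
  have hx := h x.toAdd
  rw [evalAt, AddMonoidAlgebra.lift_apply] at hx
  rw [Finsupp.linearCombination_apply, Finsupp.sum, Finset.sum_apply]
  exact hx

theorem eq_of_evalAt_of_ne {θ φ φ' : LaurentAlg n} (hθ : θ ≠ 0)
    (h : ∀ x, evalAt x θ ≠ 0 → evalAt x φ = evalAt x φ') : φ = φ' := by
  have h0 : (φ - φ') * θ = 0 := by
    apply eq_zero_of_evalAt
    intro x
    rw [map_mul, map_sub]
    by_cases hx : evalAt x θ = 0
    · rw [hx, mul_zero]
    · rw [h x hx, sub_self, zero_mul]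
  exact sub_eq_zero.1 ((mul_eq_zero.1 h0).resolve_right hθ)

/-- The Laurent polynomial which vanishes at the singular points of `A`. -/
noncomputable def singularL (n : ℕ) : LaurentAlg n :=
  (∏ i, sinhL i) * (∏ i, coshL i) * ∏ i, ∏ j ∈ Finset.Ioi i, (sinhL i ^ 2 - sinhL j ^ 2)

theorem sinh_sq_sub_sinh_sq (a b : ℂ) :
    Complex.sinh a ^ 2 - Complex.sinh b ^ 2 = Complex.sinh (a - b) * Complex.sinh (a + b) := by
  rw [Complex.sinh_sub, Complex.sinh_add]
  linear_combination Complex.sinh b ^ 2 * Complex.cosh_sq a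
    - Complex.sinh a ^ 2 * Complex.cosh_sq b

theorem singularL_ne_zero : singularL n ≠ 0 := by
  intro h
  -- The coordinates `1, …, n` are positive and distinct, so no factor vanishes.
  have h1 := congrArg (evalAt fun i : Fin n => (((i : ℕ) + 1 : ℝ) : ℂ)) h
  have hne : ∀ r : ℝ, r ≠ 0 → Complex.sinh (r : ℂ) ≠ 0 := by
    intro r hr
    rw [← Complex.ofReal_sinh, Ne, Complex.ofReal_eq_zero, Real.sinh_eq_zero]
    exact hr
  rw [map_zero] at h1
  refine absurd h1 ?_
  simp only [singularL, map_mul, map_prod, map_sub, map_pow, evalAt_sinhL, evalAt_coshL]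
  refine mul_ne_zero (mul_ne_zero ?_ ?_) ?_
  · exact Finset.prod_ne_zero_iff.2 fun i _ => hne _ (by positivity)
  · refine Finset.prod_ne_zero_iff.2 fun i _ => ?_
    rw [← Complex.ofReal_cosh, Ne, Complex.ofReal_eq_zero]
    exact (Real.cosh_pos _).ne'
  · refine Finset.prod_ne_zero_iff.2 fun i _ => Finset.prod_ne_zero_iff.2 fun j hj => ?_
    rw [sinh_sq_sub_sinh_sq, ← Complex.ofReal_sub, ← Complex.ofReal_add]
    have hij : ((i : ℕ) : ℝ) < (j : ℕ) := by exact_mod_cast Finset.mem_Ioi.1 hj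
    exact mul_ne_zero (hne _ (by linarith)) (hne _ (by positivity))

/-- The generalised Weyl denominator as a Laurent polynomial. -/
noncomputable def denominatorL (n a b v : ℕ) : LaurentAlg n :=
  (∏ i, sinhL i ^ a * (2 * coshL i) ^ b) *
    (∏ i, ∏ j ∈ Finset.Ioi i, (sinhL i ^ 2 - sinhL j ^ 2)) ^ v

/-- The formula `sinh 2x = 2 sinh x cosh x` merges the roots `ε_i` and `2ε_i` into `sinh^{κ₁+κ₃} (2
cosh)^{κ₃}`. Since `κ₁` may be negative, splitting the power of `sinh` needs `sinh x_i ≠ 0`. -/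
theorem evalAt_denominatorL {a b v : ℕ} {κ₁ κ₃ : ℤ} (ha : (a : ℤ) = κ₁ + κ₃) (hb : (b : ℤ) = κ₃)
    (x : Fin n → ℂ) (hx : ∀ i, Complex.sinh (x i) ≠ 0) :
    evalAt x (denominatorL n a b v) = weylDenominator κ₁ v κ₃ x := by
  simp only [denominatorL, weylDenominator, map_mul, map_prod, map_pow, map_sub, map_ofNat,
    evalAt_sinhL, evalAt_coshL, zpow_natCast, sinh_sq_sub_sinh_sq]
  have h1 : ∀ i, Complex.sinh (x i) ^ a * (2 * Complex.cosh (x i)) ^ b =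
      Complex.sinh (x i) ^ κ₁ * Complex.sinh (2 * x i) ^ κ₃ := by
    intro i
    rw [← zpow_natCast, ha, ← zpow_natCast, hb, zpow_add₀ (hx i), mul_assoc, ← mul_zpow,
      Complex.sinh_two_mul]
    congr 2
    ring
  simp only [h1, ← mul_pow, Finset.prod_mul_distrib, Finset.prod_pow]
  ring

end Laurent

end BCSpherical

/-! ### Factorisation of spherical functions and the main theorem. -/

namespace BCSpherical

open Matrix
open scoped TensorProduct

/-- Exponent count with `d = det N`, `s = ∏ sinh x_i`, `k = ∏ cosh x_i`: all powers of `d` cancel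
except the `ϰ_v` coming from the twist of `V`. -/
theorem eq_of_zpow_balance {d s k φ ψ : ℂ} (hd : d ≠ 0) (hs : s ≠ 0) (hk : k ≠ 0) {k₁ k₂ kt : ℤ}
    {v : ℕ} (h : d ^ k₁ * s⁻¹ ^ k₁ * (d ^ k₂ * k⁻¹ ^ k₂) * ψ =
      φ * (d ^ kt * (s * k)⁻¹ ^ kt * d ^ (-(v : ℤ) + (k₂ + k₁ - kt)))) :
    φ = d ^ v * s ^ (kt - k₁) * k ^ (kt - k₂) * ψ := by
  simp only [mul_inv, mul_zpow, _root_.inv_zpow'] at h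
  have hne : d ^ kt * (s ^ (-kt) * k ^ (-kt)) * d ^ (-(v : ℤ) + (k₂ + k₁ - kt)) ≠ 0 := by
    simp [zpow_ne_zero, hd, hs, hk]
  apply mul_right_cancel₀ hne
  rw [← h]
  have e1 : d ^ k₁ * d ^ k₂ = d ^ v * (d ^ kt * d ^ (-(v : ℤ) + (k₂ + k₁ - kt))) := by
    rw [← zpow_natCast, ← zpow_add₀ hd, ← zpow_add₀ hd, ← zpow_add₀ hd]
    congr 1
    ring
  have e2 : s ^ (-k₁) = s ^ (kt - k₁) * s ^ (-kt) := by
    rw [← zpow_add₀ hs]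
    congr 1
    ring
  have e3 : k ^ (-k₂) = k ^ (kt - k₂) * k ^ (-kt) := by
    rw [← zpow_add₀ hk]
    congr 1
    ring
  rw [e2, e3]
  linear_combination s ^ (kt - k₁) * s ^ (-kt) * k ^ (kt - k₂) * k ^ (-kt) * ψ * e1

theorem det_mul_diagTorus {n : ℕ} (e : ℤ) (h : GL (Fin n) ℂ) (t : Fin n → ℂˣ) :
    detPow e (h * diagTorus t) = detPow e h * (∏ i, (t i : ℂ)) ^ e := by
  simp [detPow, diagTorus, mul_zpow]

theorem detPow_blockDiag_one {n p : ℕ} (e : ℤ) (h : GL (Fin n) ℂ) :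
    detPow e (blockDiag h (1 : GL (Fin p) ℂ)) = detPow e h := by
  simp [detPow, coe_blockDiag]

namespace Param

variable {c : Param} {n p : ℕ} {W : Type*} [AddCommGroup W] [Module ℂ W]
  {ρ : Representation ℂ (GL (Idx₁ n p) ℂ) W}

/-- The restriction of a regular function to `A` is a Laurent polynomial. -/
theorem exists_laurent_expA {r : GL (Idx n p) ℂ → ℂ} (hr : r ∈ regularFunctions (Idx n p)) :
    ∃ φ : LaurentAlg n, ∀ x, r (expA p x) = evalAt x φ := by
  obtain ⟨k, q, hq⟩ := exists_det_pow_mul_eq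
    (hookBlocks p (diagonal coshL) (diagonal sinhL) (diagonal sinhL) (diagonal coshL) :
      Matrix (Idx n p) (Idx n p) (LaurentAlg n)) hr
  refine ⟨q, fun x => ?_⟩
  rw [← hq (evalAt x) (expA p x), det_expA, one_pow, one_mul]
  rw [coe_expA_eq_hookBlocks, hookBlocks_map]
  simp [diagonal_map]

/-- The value of a functional on a spherical function at the point `(1, 0, 1; 0, 1, 0; Z, 0, 1+Z)`,
where `Z` is the bidiagonal matrix with eigenvalues `sinh² x_i`, is a Laurent polynomial. -/
theorem exists_laurent_shearGL {r : GL (Idx n p) ℂ → ℂ} (hr : r ∈ regularFunctions (Idx n p)) :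
    ∃ ψ : LaurentAlg n, ∀ x,
      r (shearGL p (bidiag fun i => Complex.sinh (x i) ^ 2)) = evalAt x ψ := by
  obtain ⟨q, hq⟩ := exists_eval_eq
    (hookBlocks p 1 1 (bidiag fun i => sinhL i ^ 2) (1 + bidiag fun i => sinhL i ^ 2) :
      Matrix (Idx n p) (Idx n p) (LaurentAlg n)) (det_hookBlocks_shear _) hr
  refine ⟨q, fun x => hq (evalAt x) _ ?_⟩
  rw [hookBlocks_map, Matrix.map_add _ (map_add _), bidiag_map,
    Matrix.map_one _ (map_zero _) (map_one _)]
  simp [shearGL]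

/-- On regular points of `A`, a spherical function is the product of the Weyl denominator and its
value at a point which depends polynomially on `sinh² x_i`. -/
theorem IsSpherical.apply_expA_eq {f : GL (Idx n p) ℂ → W ⊗[ℂ] c.V n}
    (hf : c.IsSpherical ρ f) {w : W}
    (hL : ∀ a b, ρ (blockDiag a b) w = (detPow c.kt₁ a * detPow c.k₁ b) • w)
    {x : Fin n → ℂ} (hx : evalAt x (singularL n) ≠ 0) {φ : ℂ}
    (hφ : f (expA p x) = φ • w ⊗ₜ c.weightVec n) {ℓ : Module.Dual ℂ W} (hℓ : ℓ w = 1) :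
    φ = (∏ i, ∏ j ∈ Finset.Ioi i, (Complex.sinh (x i) ^ 2 - Complex.sinh (x j) ^ 2)) ^ c.kv *
      (∏ i, Complex.sinh (x i)) ^ (c.kt₁ - c.k₁) * (∏ i, Complex.cosh (x i)) ^ (c.kt₁ - c.k₂) *
      LinearMap.mul' ℂ ℂ (TensorProduct.map ℓ (c.evalV fun i => if (i : ℕ) = 0 then 1 else 0)
        (f (shearGL p (bidiag fun i => Complex.sinh (x i) ^ 2)))) := by
  simp only [singularL, map_mul, map_prod, map_sub, map_pow, evalAt_sinhL, evalAt_coshL] at hx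
  have hd := right_ne_zero_of_mul hx
  have hs := left_ne_zero_of_mul (left_ne_zero_of_mul hx)
  have hc := right_ne_zero_of_mul (left_ne_zero_of_mul hx)
  set z : Fin n → ℂ := fun i => Complex.sinh (x i) ^ 2
  have hdet : (newton z).det ≠ 0 := by rwa [det_newton]
  let h : GL (Fin n) ℂ := GeneralLinearGroup.mkOfDetNeZero _ hdet
  have hh : (h : Matrix (Fin n) (Fin n) ℂ) = newton z := rfl
  let s : Fin n → ℂˣ := fun i =>
    Units.mk0 (Complex.sinh (x i)) (Finset.prod_ne_zero_iff.1 hs i (Finset.mem_univ i))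
  let k : Fin n → ℂˣ := fun i =>
    Units.mk0 (Complex.cosh (x i)) (Finset.prod_ne_zero_iff.1 hc i (Finset.mem_univ i))
  have hkey := shearGL_mul_blockDiag (p := p) (bidiag z) h x s k (fun _ => rfl) (fun _ => rfl)
    (bidiag_mul_newton z)
  have h1 := congrArg f hkey
  rw [hf.right, hf.left, hφ, map_smul, TensorProduct.map_tmul, hL] at h1
  have h2 := congrArg (LinearMap.mul' ℂ ℂ ∘ₗ
    TensorProduct.map ℓ (c.evalV fun i => if (i : ℕ) = 0 then 1 else 0)) h1
  -- Evaluation at the first basis vector picks out the first row of the Newton matrix, which is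
  -- constantly 1.
  have hev : ∏ j, (∑ i, (h : Matrix (Fin n) (Fin n) ℂ) i j *
      (if (i : ℕ) = 0 then 1 else 0 : ℂ)) ^ c.kv = 1 := by
    refine Finset.prod_eq_one fun j _ => ?_
    rw [Finset.sum_eq_single ⟨0, j.pos⟩]
    · rw [hh, newton_apply_of_val_eq_zero _ rfl, if_pos rfl, mul_one, one_pow]
    · intro i _ hi
      rw [if_neg fun h0 => hi (Fin.ext h0), mul_zero]
    · simp
  have hdh : ∀ e, detPow e h =
      (∏ i, ∏ j ∈ Finset.Ioi i, (Complex.sinh (x i) ^ 2 - Complex.sinh (x j) ^ 2)) ^ e := by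
    intro e
    rw [detPow, hh, det_newton]
  simp only [map_smul, LinearMap.comp_apply, TensorProduct.map_tmul, LinearMap.mul'_apply, hℓ,
    evalV_repV_weightVec, hev, det_mul_diagTorus, detPow_blockDiag_one, detPow_one, mul_one,
    smul_eq_mul, hdh] at h2
  refine eq_of_zpow_balance hd hs hc ?_
  have hsi : ∏ i, ((s⁻¹ i : ℂˣ) : ℂ) = (∏ i, Complex.sinh (x i))⁻¹ := by
    simp [s, Finset.prod_inv_distrib]
  have hki : ∏ i, ((k⁻¹ i : ℂˣ) : ℂ) = (∏ i, Complex.cosh (x i))⁻¹ := by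
    simp [k, Finset.prod_inv_distrib]
  have hski : ∏ i, (((s * k)⁻¹ i : ℂˣ) : ℂ) =
      ((∏ i, Complex.sinh (x i)) * ∏ i, Complex.cosh (x i))⁻¹ := by
    rw [mul_inv, mul_inv, ← hsi, ← hki, ← Finset.prod_mul_distrib]
    rfl
  rwa [hsi, hki, hski] at h2

end Param

end BCSpherical

theorem mainTheorem6 (n p : ℕ) (c : Param)
    (hκ : c.κ₁ + c.κ₃ ≤ c.κ₃ ∧ 0 ≤ c.κ₁ + c.κ₃)
    {W : Type*} [AddCommGroup W] [Module ℂ W]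
    (ρ : Representation ℂ (GL (Idx₁ n p) ℂ) W) (hρ : c.IsW ρ) :
    -- the subspace of `U` in which the restrictions to `A` take their values is a line
    Module.finrank ℂ (c.subU ρ) = 1 ∧
    -- the Weyl denominator is an element `δ` of `ℂ[P]`
    ∃ δ : LaurentAlg n,
      (∀ x : Fin n → ℂ, (∀ i, Complex.sinh (x i) ≠ 0) →
        evalAt x δ = weylDenominator c.κ₁ c.κ₂ c.κ₃ x) ∧
      -- for every identification of that line with `ℂ`, the restriction of every spherical
      -- function is an element of `ℂ[P]` divisible by `δ`
      ∀ u ∈ c.subU ρ, u ≠ 0 → ∀ f, c.IsSpherical ρ f →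
        ∃ φ : LaurentAlg n, (∀ x : Fin n → ℂ, f (expA p x) = evalAt x φ • u) ∧ δ ∣ φ := by
  obtain ⟨w, hw, hL, hU⟩ := Param.IsW.exists_parabolic_vector hρ
  have hW := Param.subW_eq_span hρ hw hL hU
  have hsubU := Param.subU_eq_span hW
  obtain ⟨ℓ, hℓ⟩ := Module.Projective.exists_dual_eq_one ℂ hw
  obtain ⟨ℓ', hℓ'⟩ := Module.Projective.exists_dual_eq_one ℂ (c.weightVec_ne_zero n)
  have hu₀ : (LinearMap.mul' ℂ ℂ ∘ₗ TensorProduct.map ℓ ℓ') (w ⊗ₜ c.weightVec n) = 1 := by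
    simp [hℓ, hℓ']
  have hu₀' : w ⊗ₜ[ℂ] c.weightVec n ≠ 0 := by
    intro h
    rw [h, map_zero] at hu₀
    exact zero_ne_one hu₀
  obtain ⟨a, ha⟩ := Int.eq_ofNat_of_zero_le hκ.2
  obtain ⟨b, hb⟩ := Int.eq_ofNat_of_zero_le (hκ.2.trans hκ.1)
  refine ⟨by rw [hsubU]; exact finrank_span_singleton hu₀', denominatorL n a b c.kv,
    fun x hx => evalAt_denominatorL ha.symm hb.symm x hx, fun u hu hu0 f hf => ?_⟩
  rw [hsubU] at hu
  obtain ⟨y, rfl⟩ := Submodule.mem_span_singleton.1 hu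
  have hy : y ≠ 0 := fun h => hu0 (by rw [h, zero_smul])
  obtain ⟨φ, hφ⟩ := Param.exists_laurent_expA
    (hf.regular (LinearMap.mul' ℂ ℂ ∘ₗ TensorProduct.map ℓ ℓ'))
  have hφ' : ∀ x, f (expA p x) = evalAt x φ • w ⊗ₜ c.weightVec n := by
    intro x
    have hmem := hf.apply_expA_mem hw hL hW x
    rw [hsubU] at hmem
    obtain ⟨t, ht⟩ := Submodule.mem_span_singleton.1 hmem
    rw [← hφ, ← ht, map_smul, hu₀, smul_eq_mul, mul_one]
  obtain ⟨ψ, hψ⟩ := Param.exists_laurent_shearGL (hf.regular (LinearMap.mul' ℂ ℂ ∘ₗ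
    TensorProduct.map ℓ (c.evalV fun i => if (i : ℕ) = 0 then 1 else 0)))
  -- The factor `2^{-bn}` compensates for the `(2 cosh x_i)^b` in `δ`. Agreement at regular points
  -- suffices.
  have hmain : φ = denominatorL n a b c.kv * (((2 : ℂ)⁻¹ ^ (b * n)) • ψ) := by
    refine eq_of_evalAt_of_ne singularL_ne_zero fun x hx => ?_
    rw [hf.apply_expA_eq hL hx (hφ' x) hℓ]
    have h1 : c.kt₁ - c.k₁ = a := by rw [← ha, Param.κ₁, Param.κ₃]; ring
    have h2 : c.kt₁ - c.k₂ = b := by rw [← hb, Param.κ₃]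
    have h3 := hψ x
    rw [LinearMap.comp_apply] at h3
    rw [h1, h2, h3]
    simp only [denominatorL, map_mul, map_prod, map_pow, map_sub, map_ofNat, evalAt_sinhL,
      evalAt_coshL, map_smul, smul_eq_mul, zpow_natCast, mul_pow, Finset.prod_mul_distrib,
      Finset.prod_pow, Finset.prod_const, Finset.card_univ, Fintype.card_fin, ← pow_mul]
    have h4 : (2 : ℂ) ^ (b * n) * (2 : ℂ)⁻¹ ^ (b * n) = 1 := by
      rw [← mul_pow, mul_inv_cancel₀ two_ne_zero, one_pow]
    linear_combination
      (-((∏ i, ∏ j ∈ Finset.Ioi i, (Complex.sinh (x i) ^ 2 - Complex.sinh (x j) ^ 2)) ^ c.kv *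
        (∏ i, Complex.sinh (x i)) ^ a * (∏ i, Complex.cosh (x i)) ^ b * evalAt x ψ)) * h4
  -- The chosen vector is `y` times the reference vector, so the coordinate is divided by `y`.
  refine ⟨y⁻¹ • φ, fun x => ?_, ?_⟩
  · rw [hφ', map_smul, smul_smul, smul_eq_mul, mul_right_comm, inv_mul_cancel₀ hy, one_mul]
  · rw [hmain, ← mul_smul_comm]
    exact dvd_mul_right _ _
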